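/- Let $E$ be a finite-dimensional CW complex with $i$-cells indexed by $\mathcal E_i$ (with $\mathcal E_{-1}=\emptyset$) and incidence numbers $d_{\alpha\beta}\in\mathbb Z$ ($\alpha\in\mathcal E_{i+1}$, $\beta\in\mathcal E_i$): $d_{\alpha\beta}$ is the degree of the map $S^i\to S^i$ obtained by composing the attaching map of $\alpha$ with the collapse of the complement of the open cell $\beta$ in the $i$-skeleton. Assume that for every $\beta$ only finitely many $d_{\alpha\beta}$ are nonzero. Let $G$ be a finite abelian group with character group $\hat G$ and let $n\in\mathbb N$. For (possibly infinite) formal combinations of cells put $\partial(\sum_\alpha\chi_\alpha e_\alpha)=\sum_\beta(\sum_\alpha d_{\alpha\beta}\chi_\alpha)e_\beta$ and $\partial^T(\sum_\beta g_\beta e_\beta)=\sum_\alpha(\sum_\beta d_{\alpha\beta}g_\beta)e_\alpha$, with coefficients in $\hat G$ and $G$ respectively. Let $\mathfrak A$ be the quasi-local C*-algebra with one copy of $B(\ell^2(G))$ at each site of $\mathcal E_n$, let $\mathfrak A_\Lambda$ be the algebra of the observables supported in a finite $\Lambda\subseteq\mathcal E_n$, and for finitely supported $a\in\bigoplus_{\mathcal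 E_n}G$ and $b\in\bigoplus_{\mathcal E_n}\hat G$ let $X^a|h\rangle=|h+a\rangle$ and $Z^b|h\rangle=\prod_\sigma b_\sigma(h_\sigma)|h\rangle$. For $\alpha\in\mathcal E_{n-1}$ and $\beta\in\mathcal E_{n+1}$ put $$A_\alpha=\frac1{|G|}\sum_{g\in G}X^{\partial^T(ge_\alpha)},\qquad B_\beta=\frac1{|G|}\sum_{\chi\in\hat G}Z^{\partial(\chi e_\beta)},\qquad H_\Lambda=-\sum_{\operatorname{supp}A_\alpha\subseteq\Lambda}A_\alpha-\sum_{\operatorname{supp}B_\beta\subseteq\Lambda}B_\beta$$ for finite $\Lambda\subseteq\mathcal E_n$, where terms with empty support (multiples of the identity) are omitted. For local $A$ let $\mathcal D(A)=\lim_{\Lambda\to\mathcal E_n}i[H_\Lambda,A]$. A state $\omega$ on $\mathfrak A$ is a ground state if $-i\,\omega(A^*\mathcal D(A))\ge0$ for every finite $\Lambda\subseteq\mathcal E_n$ and every $A\in\mathfrak A_\Lambda$; it is a frustration free ground state if $\omega(A_\alpha)=\omega(B_\beta)=1$ for all $\alpha\in\mathcal E_{n-1}$, $\beta\in\mathcal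 E_{n+1}$, i.e. if it minimizes every interaction term. Let $\omega_0$ be a frustration free ground state, $\gamma\in\prod_{\mathcal E_n}\hat G$ and $\delta\in\prod_{\mathcal E_n}G$. Write $\gamma_K,\delta_K$ for the restrictions to a finite $K\subseteq\mathcal E_n$ and let $\rho_{(\gamma,\delta)}=\rho_\gamma\circ\rho_\delta$, where $\rho_\gamma(A)=\lim_{K\to\mathcal E_n}Z^{\gamma_K}AZ^{-\gamma_K}$ and $\rho_\delta(A)=\lim_{K\to\mathcal E_n}X^{\delta_K}AX^{-\delta_K}$. Then $\omega_0\circ\rho_{(\gamma,\delta)}$ is a ground state if and only if both of the following hold: 1. for every finitely supported $b\in\bigoplus_{\mathcal E_n}\hat G$, $$\lim_{K\to\mathcal E_{n-1}}\bigl(|K\cap\operatorname{supp}\partial(\gamma+b)|-|K\cap\operatorname{supp}\partial\gamma|\bigr)\ge0;$$ 2. for every finitely supported $a\in\bigoplus_{\mathcal E_n}G$, $$\lim_{K\to\mathcal E_{n+1}}\bigl(|K\cap\operatorname{supp}\partial^T(\delta+a)|-|K\cap\operatorname{supp}\partial^T\delta|\bigr)\ge0.$$ Here $K$ runs over the finite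 sets of cells ordered by inclusion, and the limits exist. -/

import Mathlib

open Filter Topology Set
open scoped ComplexOrder

noncomputable section

namespace KitaevCW

universe u v

/-! ## Degrees of self-maps of spheres -/

/-- Singular homology with integer coefficients. -/
abbrev singularH (k : ℕ) (Y : Type) [TopologicalSpace Y] : ModuleCat.{0} ℤ :=
  ((AlgebraicTopology.singularHomologyFunctor (ModuleCat.{0} ℤ) k).obj (ModuleCat.of ℤ ℤ)).obj
    (TopCat.of Y)

/-- The map induced by a continuous map on singular homology. -/
def singularHMap (k : ℕ) {Y Y' : Type} [TopologicalSpace Y] [TopologicalSpace Y'] (f : C(Y, Y')) :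
    singularH k Y →ₗ[ℤ] singularH k Y' :=
  (((AlgebraicTopology.singularHomologyFunctor (ModuleCat.{0} ℤ) k).obj (ModuleCat.of ℤ ℤ)).map
    (TopCat.ofHom f)).hom

theorem singularHMap_comp (k : ℕ) {Y Y' Y'' : Type} [TopologicalSpace Y] [TopologicalSpace Y']
    [TopologicalSpace Y''] (g : C(Y', Y'')) (f : C(Y, Y')) (x : singularH k Y) :
    singularHMap k (g.comp f) x = singularHMap k g (singularHMap k f x) := by
  simp [singularHMap]

/-- Reduced singular homology: the kernel of the map induced by `Y → pt`. -/
def reducedH (k : ℕ) (Y : Type) [TopologicalSpace Y] : Submodule ℤ (singularH k Y) :=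
  LinearMap.ker (singularHMap k (ContinuousMap.const Y PUnit.unit))

/-- The map induced by a continuous self-map on reduced singular homology. -/
def reducedHMap (k : ℕ) {Y : Type} [TopologicalSpace Y] (f : C(Y, Y)) :
    reducedH k Y →ₗ[ℤ] reducedH k Y :=
  AddMonoidHom.toIntLinearMap <| LinearMap.toAddMonoidHom <|
    (singularHMap k f).restrict (p := reducedH k Y) (q := reducedH k Y) (fun x hx => by
    have h : (ContinuousMap.const Y PUnit.unit).comp f = ContinuousMap.const Y PUnit.unit := rfl
    simp only [reducedH, LinearMap.mem_ker] at hx ⊢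
    rw [← singularHMap_comp, h, hx])

/-- The `k`-sphere, realized as the boundary of the cube `[-1, 1]^(k+1)`, i.e. as the unit sphere of
the maximum norm. -/
abbrev Sph (k : ℕ) : Type := Metric.sphere (0 : Fin (k + 1) → ℝ) 1

/-- The degree of a continuous map `S^k → S^k`. Since `H̃_k(S^k; ℤ)` is infinite cyclic, the induced
endomorphism is the multiplication by an integer, which is its trace. -/
def degree {k : ℕ} (f : C(Sph k, Sph k)) : ℤ :=
  LinearMap.trace ℤ (reducedH k (Sph k)) (reducedHMap k f)

theorem degree_const {k : ℕ} (y : Sph k) : degree (ContinuousMap.const (Sph k) y) = 0 := by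
  have h : reducedHMap k (ContinuousMap.const (Sph k) y) = 0 := by
    ext ⟨x, hx⟩
    have h2 : (ContinuousMap.const PUnit y).comp (ContinuousMap.const (Sph k) PUnit.unit) =
        ContinuousMap.const (Sph k) y := rfl
    rw [reducedH, LinearMap.mem_ker] at hx
    have : singularHMap k (ContinuousMap.const (Sph k) y) x = 0 := by
      rw [← h2, singularHMap_comp, hx, map_zero]
    simpa [reducedHMap, LinearMap.restrict_apply] using this
  rw [degree, h, map_zero]

/-! ## Incidence numbers of a CW complex -/

/-- A vector in the direction of the image of `u` under the collapse map. -/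
def collapseVec (k : ℕ) (u : Fin k → ℝ) : Fin (k + 1) → ℝ :=
  Fin.cons (1 - 2 * ‖u‖) ((1 - ‖u‖) • u)

theorem collapseVec_ne_zero (k : ℕ) (u : Fin k → ℝ) : collapseVec k u ≠ 0 := by
  intro h
  have h0 : 1 - 2 * ‖u‖ = 0 := by simpa [collapseVec] using congrFun h 0
  have h1 : (1 - ‖u‖) • u = 0 := by
    ext j
    simpa [collapseVec] using congrFun h j.succ
  have h2 : ‖u‖ = 1 / 2 := by linarith
  rcases smul_eq_zero.1 h1 with h3 | h3
  · linarith
  · rw [h3, norm_zero] at h2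
    norm_num at h2

/-- The map `D^k → S^k` which sends the centre to the north pole `(1, 0)`, maps the interior
homeomorphically onto the complement of the south pole `(-1, 0)`, and collapses the boundary `∂D^k`
to the south pole. It identifies `D^k / ∂D^k` with `S^k`. -/
def collapse (k : ℕ) (u : Fin k → ℝ) : Sph k :=
  ⟨‖collapseVec k u‖⁻¹ • collapseVec k u, by
    have := norm_ne_zero_iff.2 (collapseVec_ne_zero k u)
    simp [norm_smul, this]⟩

/-- The south pole `(-1, 0)` of `S^k`. -/
def southPole (k : ℕ) : Sph k :=
  ⟨Fin.cons (-1) 0, by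
    have h : ‖(Fin.cons (-1) 0 : Fin (k + 1) → ℝ)‖ = 1 := by
      apply le_antisymm
      · rw [pi_norm_le_iff_of_nonneg zero_le_one]
        intro j
        refine Fin.cases ?_ (fun j => ?_) j <;> simp
      · simpa using norm_le_pi_norm (Fin.cons (-1) 0 : Fin (k + 1) → ℝ) 0
    simpa using h⟩

theorem continuous_collapse (k : ℕ) : Continuous (collapse k) := by
  have h : Continuous (collapseVec k) := by
    refine continuous_pi fun j => ?_
    refine Fin.cases ?_ (fun j => ?_) j
    · simp only [collapseVec, Fin.cons_zero]; fun_prop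
    · simp only [collapseVec, Fin.cons_succ]; fun_prop
  refine Continuous.subtype_mk ?_ _
  exact (h.norm.inv₀ fun u => norm_ne_zero_iff.2 (collapseVec_ne_zero k u)).smul h

theorem collapse_of_norm_eq_one {k : ℕ} {u : Fin k → ℝ} (hu : ‖u‖ = 1) :
    collapse k u = southPole k := by
  have h : collapseVec k u = (southPole k : Fin (k + 1) → ℝ) := by
    have : (1 : ℝ) - 2 = -1 := by norm_num
    simp [collapseVec, southPole, hu, this]
  have h1 : ‖(southPole k : Fin (k + 1) → ℝ)‖ = 1 := by simp
  apply Subtype.ext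
  simp only [collapse]
  rw [h, h1]
  simp

variable {X : Type u} [TopologicalSpace X]

open Classical in
/-- The map `E^i → E^i / (E^i ∖ e_β) ≅ D^i / ∂D^i ≅ S^i` which collapses the complement of the open
`i`-cell `β` in the `i`-skeleton to a point. -/
def collapseOutside (E : Set X) [CWComplex E] (i : ℕ) (β : RelCWComplex.cell E i) (x : X) : Sph i :=
  if x ∈ RelCWComplex.openCell i β then collapse i ((RelCWComplex.map i β).symm x) else southPole i

theorem collapseOutside_map (E : Set X) [CWComplex E] (i : ℕ) (β : RelCWComplex.cell E i)
    {u : Fin i → ℝ} (hu : u ∈ Metric.closedBall 0 1)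
    (hd : Disjoint (RelCWComplex.cellFrontier i β) (RelCWComplex.openCell i β)) :
    collapseOutside E i β (RelCWComplex.map i β u) = collapse i u := by
  rw [← Metric.sphere_union_ball] at hu
  rcases hu with hu | hu
  · rw [collapseOutside, if_neg (disjoint_left.1 hd (mem_image_of_mem _ hu)),
      collapse_of_norm_eq_one (by simpa using hu)]
  · have hu' : RelCWComplex.map i β u ∈ RelCWComplex.openCell i β := mem_image_of_mem _ hu
    rw [collapseOutside, if_pos hu', PartialEquiv.left_inv]
    rw [RelCWComplex.source_eq]
    exact hu

theorem continuousOn_collapseOutside [T2Space X] (E : Set X) [CWComplex E] (i : ℕ)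
    (β : RelCWComplex.cell E i) :
    ContinuousOn (collapseOutside E i β) (RelCWComplex.skeletonLT E (i + 1 : ℕ) : Set X) := by
  classical
  have hlt : Disjoint (RelCWComplex.skeletonLT E (i : ℕ) : Set X) (RelCWComplex.openCell i β) :=
    RelCWComplex.disjoint_skeletonLT_openCell le_rfl
  have hd : Disjoint (RelCWComplex.cellFrontier i β) (RelCWComplex.openCell i β) :=
    hlt.mono_left (RelCWComplex.cellFrontier_subset_skeletonLT i β)
  have key : ∀ F : Set (Sph i), ∀ S : Set X, Disjoint S (RelCWComplex.openCell i β) → IsClosed S →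
      IsClosed (collapseOutside E i β ⁻¹' F ∩ S) := by
    intro F S hS hS'
    by_cases hF : southPole i ∈ F
    · convert hS' using 1
      apply inter_eq_right.2
      intro x hx
      rw [mem_preimage, collapseOutside, if_neg (disjoint_left.1 hS hx)]
      exact hF
    · convert isClosed_empty using 1
      apply eq_empty_of_forall_notMem
      rintro x ⟨hx, hxS⟩
      rw [mem_preimage, collapseOutside, if_neg (disjoint_left.1 hS hxS)] at hx
      exact hF hx
  rw [continuousOn_iff_isClosed]
  intro F hF
  refine ⟨collapseOutside E i β ⁻¹' F ∩ RelCWComplex.skeletonLT E (i + 1 : ℕ), ?_, by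
    rw [inter_assoc, inter_self]⟩
  apply CWComplex.isClosed_of_isClosed_inter_openCell_or_isClosed_inter_closedCell (C := E)
    (inter_subset_right.trans (RelCWComplex.Subcomplex.subset_complex _))
  intro m hm j
  rcases lt_trichotomy m i with hmi | rfl | hmi
  · right
    have h1 : RelCWComplex.closedCell m j ⊆ (RelCWComplex.skeletonLT E (i : ℕ) : Set X) :=
      (RelCWComplex.closedCell_subset_skeletonLT m j).trans
        (RelCWComplex.skeletonLT_mono (by exact_mod_cast hmi))
    have h2 : (RelCWComplex.skeletonLT E (i : ℕ) : Set X) ⊆ RelCWComplex.skeletonLT E (i + 1 : ℕ) :=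
      RelCWComplex.skeletonLT_mono (by exact_mod_cast Nat.le_succ i)
    rw [inter_assoc, inter_eq_right.2 (h1.trans h2)]
    exact key F _ (hlt.mono_left h1) RelCWComplex.isClosed_closedCell
  · right
    have h1 : RelCWComplex.closedCell m j ⊆ (RelCWComplex.skeletonLT E (m + 1 : ℕ) : Set X) := by
      exact_mod_cast RelCWComplex.closedCell_subset_skeletonLT m j
    rw [inter_assoc, inter_eq_right.2 h1]
    by_cases hj : j = β
    · subst hj
      have : collapseOutside E m j ⁻¹' F ∩ RelCWComplex.closedCell m j =
          RelCWComplex.map m j '' (Metric.closedBall 0 1 ∩ collapse m ⁻¹' F) := by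
        ext x
        constructor
        · rintro ⟨hx, u, hu, rfl⟩
          refine ⟨u, ⟨hu, ?_⟩, rfl⟩
          rw [mem_preimage, collapseOutside_map E m j hu hd] at hx
          exact hx
        · rintro ⟨u, ⟨hu, hF'⟩, rfl⟩
          refine ⟨?_, mem_image_of_mem _ hu⟩
          rw [mem_preimage, collapseOutside_map E m j hu hd]
          exact hF'
      rw [this]
      apply IsCompact.isClosed
      apply IsCompact.image_of_continuousOn
      · exact (isCompact_closedBall _ _).inter_right (hF.preimage (continuous_collapse m))
      · exact (RelCWComplex.continuousOn m j).mono inter_subset_left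
    · apply key F _ _ RelCWComplex.isClosed_closedCell
      rw [← RelCWComplex.cellFrontier_union_openCell_eq_closedCell, disjoint_union_left]
      refine ⟨hlt.mono_left (RelCWComplex.cellFrontier_subset_skeletonLT m j), ?_⟩
      exact RelCWComplex.disjoint_openCell_of_ne (by simpa using hj)
  · left
    have : Disjoint (RelCWComplex.skeletonLT E (i + 1 : ℕ) : Set X) (RelCWComplex.openCell m j) :=
      RelCWComplex.disjoint_skeletonLT_openCell (by exact_mod_cast hmi)
    rw [inter_assoc, disjoint_iff_inter_eq_empty.1 this, inter_empty]
    exact isClosed_empty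

/-- The map `S^i → E^i → S^i` obtained from the attaching map of the `(i+1)`-cell `α` by collapsing
the complement of the `i`-cell `β` to a point. -/
def attachCollapse [T2Space X] (E : Set X) [CWComplex E] (i : ℕ) (α : RelCWComplex.cell E (i + 1))
    (β : RelCWComplex.cell E i) : C(Sph i, Sph i) where
  toFun x := collapseOutside E i β (RelCWComplex.map (i + 1) α x)
  continuous_toFun := by
    refine (continuousOn_collapseOutside E i β).comp_continuous ?_ ?_
    · exact ((RelCWComplex.continuousOn (i + 1) α).mono
        Metric.sphere_subset_closedBall).comp_continuous continuous_subtype_val (fun x => x.2)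
    · exact fun x =>
        RelCWComplex.cellFrontier_subset_skeletonLT (i + 1) α (mem_image_of_mem _ x.2)

/-- The incidence number `d_{αβ}` of an `(i+1)`-cell `α` and an `i`-cell `β`. The orientations of the
cells are those given by their characteristic maps. -/
def incidence [T2Space X] (E : Set X) [CWComplex E] (i : ℕ) (α : RelCWComplex.cell E (i + 1))
    (β : RelCWComplex.cell E i) : ℤ :=
  degree (attachCollapse E i α β)

/-- A cell is incident to only finitely many cells of one dimension less. -/
theorem finite_incidence_left [T2Space X] (E : Set X) [CWComplex E] (i : ℕ)
    (α : RelCWComplex.cell E (i + 1)) : {β | incidence E i α β ≠ 0}.Finite := by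
  obtain ⟨I, hI⟩ := CWComplex.cellFrontier_subset_finite_openCell (i + 1) α
  refine (I i).finite_toSet.subset fun β hβ => ?_
  by_contra hβI
  apply hβ
  have : attachCollapse E i α β = ContinuousMap.const _ (southPole i) := by
    ext1 x
    change collapseOutside E i β _ = _
    rw [collapseOutside, if_neg]
    · rfl
    intro hx
    have hx' := hI (mem_image_of_mem _ x.2)
    simp only [mem_iUnion] at hx'
    obtain ⟨m, -, j, hj, hxj⟩ := hx'
    by_cases h : (⟨m, j⟩ : Σ n, RelCWComplex.cell E n) = ⟨i, β⟩
    · cases h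
      exact hβI hj
    · exact disjoint_left.1 (RelCWComplex.disjoint_openCell_of_ne h) hxj hx
  rw [incidence, this, degree_const]

/-- The standing assumption on the complex: every cell is incident to only finitely many cells of
one dimension more. -/
def LocallyFiniteIncidence [T2Space X] (E : Set X) [CWComplex E] : Prop :=
  ∀ (i : ℕ) (β : RelCWComplex.cell E i), {α | incidence E i α β ≠ 0}.Finite

/-! ## The quasi-local algebra -/

section Algebra

variable {S : Type u} {G : Type v} [AddCommGroup G]

/-- The Hilbert space `ℓ²(S →₀ G)`, on which the quasi-local algebra of a system with the one-site
Hilbert space `ℓ²(G)` at each site of `S` acts faithfully. For every finite `Λ ⊆ S` it is the tensor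
product of `⨂_{σ ∈ Λ} ℓ²(G)` and `ℓ²((S ∖ Λ) →₀ G)`. -/
abbrev Hilb (S : Type u) (G : Type v) [AddCommGroup G] : Type (max u v) :=
  lp (fun _ : S →₀ G => ℂ) 2

theorem memℓp_weighted (w : (S →₀ G) → ℂ) (C : ℝ) (hw : ∀ h, ‖w h‖ ≤ C) (c : S →₀ G)
    (ψ : Hilb S G) : Memℓp (fun h => w h * ψ (h + c)) 2 := by
  have h0 : (0 : ℝ) < (2 : ENNReal).toReal := by norm_num
  rw [memℓp_gen_iff h0]
  have h1 : Summable fun h => ‖ψ h‖ ^ (2 : ENNReal).toReal := (memℓp_gen_iff h0).1 (lp.memℓp ψ)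
  have h2 := ((Equiv.addRight c).summable_iff.2 h1).mul_left (C ^ (2 : ENNReal).toReal)
  refine Summable.of_nonneg_of_le (fun h => by positivity) (fun h => ?_) h2
  rw [norm_mul, Real.mul_rpow (norm_nonneg _) (norm_nonneg _)]
  simp only [Function.comp, Equiv.coe_addRight]
  gcongr
  exact hw h

/-- The bounded operator `(W ψ)(h) = w(h) ψ(h + c)` for a bounded function `w`. -/
def weightedShift (w : (S →₀ G) → ℂ) (C : ℝ) (hw : ∀ h, ‖w h‖ ≤ C) (c : S →₀ G) :
    Hilb S G →L[ℂ] Hilb S G :=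
  LinearMap.mkContinuous
    { toFun := fun ψ => ⟨fun h => w h * ψ (h + c), memℓp_weighted w C hw c ψ⟩
      map_add' := fun ψ φ => by
        apply lp.ext
        funext h
        exact mul_add _ _ _
      map_smul' := fun z ψ => by
        apply lp.ext
        funext h
        exact mul_left_comm _ _ _ }
    C (fun ψ => by
      have h0 : (0 : ℝ) < (2 : ENNReal).toReal := by norm_num
      have hC : 0 ≤ C := (norm_nonneg _).trans (hw 0)
      apply lp.norm_le_of_tsum_le h0 (by positivity)
      have h1 : Summable fun h => ‖ψ h‖ ^ (2 : ENNReal).toReal :=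
        (memℓp_gen_iff h0).1 (lp.memℓp ψ)
      have h2 := ((Equiv.addRight c).summable_iff.2 h1).mul_left (C ^ (2 : ENNReal).toReal)
      rw [Real.mul_rpow hC (norm_nonneg _), lp.norm_rpow_eq_tsum h0, ← tsum_mul_left,
        ← (Equiv.addRight c).tsum_eq (fun h => C ^ (2 : ENNReal).toReal *
          ‖ψ h‖ ^ (2 : ENNReal).toReal)]
      refine Summable.tsum_le_tsum (fun h => ?_)
        ((memℓp_gen_iff h0).1 (memℓp_weighted w C hw c ψ)) h2
      change ‖w h * ψ (h + c)‖ ^ (2 : ENNReal).toReal ≤ _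
      rw [norm_mul, Real.mul_rpow (norm_nonneg _) (norm_nonneg _)]
      simp only [Equiv.coe_addRight]
      gcongr
      exact hw h)

theorem weightedShift_apply (w : (S →₀ G) → ℂ) (C : ℝ) (hw : ∀ h, ‖w h‖ ≤ C) (c : S →₀ G)
    (ψ : Hilb S G) (h : S →₀ G) : weightedShift w C hw c ψ h = w h * ψ (h + c) := rfl

variable [Fintype G]

/-- The operator `(M)_σ` on a single site: the matrix `M` acts on the tensor factor `ℓ²(G)` at the
site `σ`, i.e. `((M)_σ ψ)(h) = ∑_k M(h(σ), k) ψ(h')`, where `h'` is obtained from `h` by changing the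
value at `σ` to `k`. In the sum below `k = h(σ) + c`. -/
def siteOp (σ : S) (M : Matrix G G ℂ) : Hilb S G →L[ℂ] Hilb S G :=
  ∑ c : G, weightedShift (fun h => M (h σ) (h σ + c)) (∑ i, ∑ j, ‖M i j‖)
    (fun h => (Finset.single_le_sum (f := fun j => ‖M (h σ) j‖)
        (fun _ _ => norm_nonneg _) (Finset.mem_univ _)).trans
      (Finset.single_le_sum (f := fun i => ∑ j, ‖M i j‖)
        (fun _ _ => Finset.sum_nonneg fun _ _ => norm_nonneg _) (Finset.mem_univ _)))
    (Finsupp.single σ c)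

theorem siteOp_apply (σ : S) (M : Matrix G G ℂ) (ψ : Hilb S G) (h : S →₀ G) :
    siteOp σ M ψ h = ∑ c : G, M (h σ) (h σ + c) * ψ (h + Finsupp.single σ c) := by
  rw [siteOp, sum_apply, lp.coeFn_sum, Finset.sum_apply]
  rfl

/-- The algebra `𝔄_Λ = B(⨂_{σ ∈ Λ} ℓ²(G))` of the observables supported in `Λ`, for finite `Λ`: it is
generated by the operators on the single sites of `Λ`. -/
def localAlg (G : Type v) [AddCommGroup G] [Fintype G] (Λ : Set S) :
    StarSubalgebra ℂ (Hilb S G →L[ℂ] Hilb S G) :=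
  StarAlgebra.adjoin ℂ {T | ∃ σ ∈ Λ, ∃ M : Matrix G G ℂ, T = siteOp σ M}

/-- The quasi-local C*-algebra `𝔄`: the norm closure of the algebra of all local observables. -/
abbrev QuasiLocal (S : Type u) (G : Type v) [AddCommGroup G] [Fintype G] : Type (max u v) :=
  (localAlg G (univ : Set S)).topologicalClosure

/-- The generalized Pauli operator `X^a`, `X^a |h⟩ = |h + a⟩`, on the Hilbert space. -/
def pauliXOp (a : S →₀ G) : Hilb S G →L[ℂ] Hilb S G :=
  weightedShift (fun _ => 1) 1 (fun _ => by simp) (-a)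

/-- The generalized Pauli operator `Z^b`, `Z^b |h⟩ = ∏_σ b_σ(h_σ) |h⟩`, on the Hilbert space. -/
def pauliZOp (b : S →₀ AddChar G ℂ) : Hilb S G →L[ℂ] Hilb S G :=
  weightedShift (fun h => b.prod fun σ χ => χ (h σ)) 1
    (fun h => by rw [Finsupp.prod, norm_prod]; simp) 0

theorem pauliXOp_mem (a : S →₀ G) : pauliXOp a ∈ localAlg G (univ : Set S) := by
  classical
  induction a using Finsupp.induction with
  | zero =>
    convert one_mem (localAlg G (univ : Set S)) using 1
    ext ψ h
    simp [pauliXOp, weightedShift_apply]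
  | single_add σ g a _ _ ih =>
    have hs : siteOp σ (Matrix.of fun h k => if h = k + g then 1 else 0) ∈ localAlg G (univ : Set S) :=
      StarAlgebra.subset_adjoin ℂ _ ⟨σ, mem_univ σ, _, rfl⟩
    have key : ∀ (ψ : Hilb S G) (h : S →₀ G), pauliXOp (Finsupp.single σ g + a) ψ h =
        siteOp σ (Matrix.of fun h k => if h = k + g then 1 else 0) (pauliXOp a ψ) h := by
      intro ψ h
      rw [siteOp_apply, Finset.sum_eq_single (-g)]
      · simp only [pauliXOp, weightedShift_apply, Matrix.of_apply, neg_add_cancel_right, if_true, one_mul,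
          neg_add_rev, Finsupp.single_neg]
        abel_nf
      · intro c _ hc
        rw [Matrix.of_apply, if_neg, zero_mul]
        intro h'
        apply hc
        rw [add_assoc, left_eq_add] at h'
        exact eq_neg_of_add_eq_zero_left h'
      · simp
    have h2 : pauliXOp (Finsupp.single σ g + a) = siteOp σ (Matrix.of fun h k => if h = k + g then 1 else 0) * pauliXOp a :=
      ContinuousLinearMap.ext fun ψ => lp.ext (funext fun h => key ψ h)
    rw [h2]
    exact mul_mem hs ih

theorem pauliZOp_mem (b : S →₀ AddChar G ℂ) : pauliZOp b ∈ localAlg G (univ : Set S) := by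
  classical
  induction b using Finsupp.induction with
  | zero =>
    convert one_mem (localAlg G (univ : Set S)) using 1
    ext ψ h
    simp [pauliZOp, weightedShift_apply]
  | single_add σ χ b hσ _ ih =>
    have hs : siteOp σ (Matrix.of fun h k => if h = k then χ h else 0) ∈ localAlg G (univ : Set S) :=
      StarAlgebra.subset_adjoin ℂ _ ⟨σ, mem_univ σ, _, rfl⟩
    have key : ∀ (ψ : Hilb S G) (h : S →₀ G), pauliZOp (Finsupp.single σ χ + b) ψ h =
        siteOp σ (Matrix.of fun h k => if h = k then χ h else 0) (pauliZOp b ψ) h := by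
      intro ψ h
      rw [siteOp_apply, Finset.sum_eq_single 0]
      · simp only [pauliZOp, weightedShift_apply]
        rw [Finsupp.prod_add_index' (h := fun σ (χ : AddChar G ℂ) => χ (h σ)) (by simp)
          (by simp [AddChar.add_apply]), Finsupp.prod_single_index (by simp)]
        simp [mul_assoc]
      · intro c _ hc
        rw [Matrix.of_apply, if_neg, zero_mul]
        intro h'
        exact hc (left_eq_add.1 h')
      · simp
    have h2 : pauliZOp (Finsupp.single σ χ + b) = siteOp σ (Matrix.of fun h k => if h = k then χ h else 0) * pauliZOp b :=
      ContinuousLinearMap.ext fun ψ => lp.ext (funext fun h => key ψ h)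
    rw [h2]
    exact mul_mem hs ih

/-- `X^a` as a quasi-local observable. -/
def pauliX (a : S →₀ G) : QuasiLocal S G :=
  ⟨pauliXOp a, StarSubalgebra.le_topologicalClosure _ (pauliXOp_mem a)⟩

/-- `Z^b` as a quasi-local observable. -/
def pauliZ (b : S →₀ AddChar G ℂ) : QuasiLocal S G :=
  ⟨pauliZOp b, StarSubalgebra.le_topologicalClosure _ (pauliZOp_mem b)⟩

/-- A state: a positive normalized linear functional. -/
structure IsState (ω : QuasiLocal S G → ℂ) : Prop where
  linear : IsLinearMap ℂ ω
  nonneg : ∀ A, 0 ≤ ω (star A * A)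
  map_one : ω 1 = 1

/-! ## The endomorphisms -/

/-- The restriction of a possibly infinite (co)chain to a finite set of cells. -/
def restr {M : Type*} [Zero M] (γ : S → M) (K : Finset S) : S →₀ M :=
  Finsupp.indicator K fun σ _ => γ σ

/-- `ρ_γ(A) = lim_K Z^{γ_K} A Z^{-γ_K}`, a norm limit. -/
def rhoZ (γ : S → AddChar G ℂ) (A : QuasiLocal S G) : QuasiLocal S G :=
  limUnder atTop fun K : Finset S => pauliZ (restr γ K) * A * pauliZ (-restr γ K)

/-- `ρ_δ(A) = lim_K X^{δ_K} A X^{-δ_K}`, a norm limit. -/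
def rhoX (δ : S → G) (A : QuasiLocal S G) : QuasiLocal S G :=
  limUnder atTop fun K : Finset S => pauliX (restr δ K) * A * pauliX (-restr δ K)

/-- `ρ_(γ,δ) = ρ_γ ∘ ρ_δ`. -/
def rho (γ : S → AddChar G ℂ) (δ : S → G) : QuasiLocal S G → QuasiLocal S G :=
  rhoZ γ ∘ rhoX δ

end Algebra

/-! ## The model -/

/-- The cells of three consecutive dimensions of a cell complex with their incidence numbers:
`Mid` stands for the `n`-cells, `Low` for the `(n-1)`-cells, and `High` for the `(n+1)`-cells. Each
cell is incident to finitely many cells. -/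
structure CellSystem where
  Low : Type u
  Mid : Type u
  High : Type u
  dLow : Mid → Low → ℤ
  dHigh : High → Mid → ℤ
  finite_dLow_left : ∀ σ, {α | dLow σ α ≠ 0}.Finite
  finite_dLow_right : ∀ α, {σ | dLow σ α ≠ 0}.Finite
  finite_dHigh_left : ∀ β, {σ | dHigh β σ ≠ 0}.Finite
  finite_dHigh_right : ∀ σ, {β | dHigh β σ ≠ 0}.Finite

/-- The cells of dimension `n - 1`; there are none for `n = 0`. -/
def LowerCell (E : Set X) [CWComplex E] : ℕ → Type u
  | 0 => PEmpty
  | n + 1 => RelCWComplex.cell E n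

/-- The incidence numbers of the `n`-cells and the `(n-1)`-cells. -/
def lowerIncidence [T2Space X] (E : Set X) [CWComplex E] :
    (n : ℕ) → RelCWComplex.cell E n → LowerCell E n → ℤ
  | 0 => fun _ α => α.elim
  | n + 1 => incidence E n

/-- The cells of dimensions `n - 1`, `n` and `n + 1` of a CW complex. -/
def cellSystem [T2Space X] (E : Set X) [CWComplex E] (hE : LocallyFiniteIncidence E) (n : ℕ) :
    CellSystem.{u} where
  Low := LowerCell E n
  Mid := RelCWComplex.cell E n
  High := RelCWComplex.cell E (n + 1)
  dLow := lowerIncidence E n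
  dHigh := incidence E n
  finite_dLow_left := match n with
    | 0 => fun _ => have : IsEmpty (LowerCell E 0) := inferInstanceAs (IsEmpty PEmpty)
      Set.toFinite _
    | n + 1 => finite_incidence_left E n
  finite_dLow_right := match n with
    | 0 => fun α => α.elim
    | n + 1 => hE n
  finite_dHigh_left := finite_incidence_left E n
  finite_dHigh_right := hE n

/-- The boundary `∂(∑ c_α e_α) = ∑_β (∑_α d_{αβ} c_α) e_β` of a (locally finite) chain. -/
def boundary {I J M : Type*} [AddCommGroup M] (d : I → J → ℤ) (c : I → M) : J → M :=
  fun β => ∑ᶠ α, d α β • c α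

/-- The coboundary `∂ᵀ(∑ c_β e_β) = ∑_α (∑_β d_{αβ} c_β) e_α` of a cochain. -/
def coboundary {I J M : Type*} [AddCommGroup M] (d : I → J → ℤ) (c : J → M) : I → M :=
  fun α => ∑ᶠ β, d α β • c β

theorem boundary_single {I J M : Type*} [AddCommGroup M] [DecidableEq I] (d : I → J → ℤ)
    (α : I) (m : M) (β : J) : boundary d (Pi.single α m) β = d α β • m := by
  rw [boundary, finsum_eq_single _ α (fun x hx => by simp [hx]), Pi.single_eq_same]

theorem coboundary_single {I J M : Type*} [AddCommGroup M] [DecidableEq J] (d : I → J → ℤ)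
    (β : J) (m : M) (α : I) : coboundary d (Pi.single β m) α = d α β • m :=
  boundary_single (fun β α => d α β) β m α

namespace CellSystem

variable (T : CellSystem.{u}) {G : Type v} [AddCommGroup G]

open Classical in
/-- The locally finite cochain `∂ᵀ(g e_α)` for an `(n-1)`-cell `α`. -/
def starCochain (α : T.Low) (g : G) : T.Mid →₀ G :=
  Finsupp.ofSupportFinite (coboundary T.dLow (Pi.single α g))
    ((T.finite_dLow_right α).subset fun σ hσ => by
      rw [Function.mem_support, coboundary_single] at hσ
      exact fun h => hσ (by rw [h, zero_zsmul]))

open Classical in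
/-- The chain `∂(χ e_β)` for an `(n+1)`-cell `β`. -/
def plaquetteChain (β : T.High) (χ : AddChar G ℂ) : T.Mid →₀ AddChar G ℂ :=
  Finsupp.ofSupportFinite (boundary T.dHigh (Pi.single β χ))
    ((T.finite_dHigh_left β).subset fun σ hσ => by
      rw [Function.mem_support, boundary_single] at hσ
      exact fun h => hσ (by rw [h, zero_zsmul]))

variable (G) in
/-- The star operator `A_α = |G|⁻¹ ∑_g X^{∂ᵀ(g e_α)}`. -/
def starOp [Fintype G] (α : T.Low) : QuasiLocal T.Mid G :=
  (Fintype.card G : ℂ)⁻¹ • ∑ g : G, pauliX (T.starCochain α g)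

variable (G) in
/-- The plaquette operator `B_β = |G|⁻¹ ∑_χ Z^{∂(χ e_β)}`. -/
def plaquetteOp [Fintype G] (β : T.High) : QuasiLocal T.Mid G :=
  (Fintype.card G : ℂ)⁻¹ • ∑ χ : AddChar G ℂ, pauliZ (T.plaquetteChain β χ)

variable (G) in
/-- The support of the star operator `A_α`. -/
def starSupp (α : T.Low) : Set T.Mid := {σ | ∃ g : G, T.starCochain α g σ ≠ 0}

variable (G) in
/-- The support of the plaquette operator `B_β`. -/
def plaquetteSupp (β : T.High) : Set T.Mid :=
  {σ | ∃ χ : AddChar G ℂ, T.plaquetteChain β χ σ ≠ 0}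

variable (G) in
/-- The `(n-1)`-cells whose star operators contribute to the Hamiltonian of `Λ`. Star operators with
empty support are multiples of the identity; as there may be infinitely many of them, and as they do
not contribute to commutators, they are left out. -/
def starsIn (Λ : Finset T.Mid) : Set T.Low :=
  {α | (T.starSupp G α).Nonempty ∧ T.starSupp G α ⊆ Λ}

variable (G) in
/-- The `(n+1)`-cells whose plaquette operators contribute to the Hamiltonian of `Λ`. -/
def plaquettesIn (Λ : Finset T.Mid) : Set T.High :=
  {β | (T.plaquetteSupp G β).Nonempty ∧ T.plaquetteSupp G β ⊆ Λ}

theorem finite_starsIn (Λ : Finset T.Mid) : (T.starsIn G Λ).Finite := by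
  classical
  refine (Λ.finite_toSet.biUnion fun σ _ => T.finite_dLow_left σ).subset ?_
  rintro α ⟨⟨σ, hσ⟩, h⟩
  refine mem_iUnion₂.2 ⟨σ, h hσ, fun h0 => ?_⟩
  obtain ⟨g, hg⟩ := hσ
  apply hg
  change coboundary T.dLow (Pi.single α g) σ = 0
  rw [coboundary_single, h0, zero_zsmul]

theorem finite_plaquettesIn (Λ : Finset T.Mid) : (T.plaquettesIn G Λ).Finite := by
  classical
  refine (Λ.finite_toSet.biUnion fun σ _ => T.finite_dHigh_right σ).subset ?_
  rintro β ⟨⟨σ, hσ⟩, h⟩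
  refine mem_iUnion₂.2 ⟨σ, h hσ, fun h0 => ?_⟩
  obtain ⟨χ, hχ⟩ := hσ
  apply hχ
  change boundary T.dHigh (Pi.single β χ) σ = 0
  rw [boundary_single, h0, zero_zsmul]

variable [Fintype G]

variable (G) in
/-- The local Hamiltonian `H_Λ`: minus the sum of the star and plaquette operators supported in
`Λ`. -/
def hamiltonian (Λ : Finset T.Mid) : QuasiLocal T.Mid G :=
  - (∑ α ∈ (T.finite_starsIn (G := G) Λ).toFinset, T.starOp G α)
    - ∑ β ∈ (T.finite_plaquettesIn (G := G) Λ).toFinset, T.plaquetteOp G β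

/-- `D = δ(A)` for the derivation `δ(A) = lim_Λ i [H_Λ, A]` (a norm limit). -/
def IsDerivation (A D : QuasiLocal T.Mid G) : Prop :=
  Tendsto (fun Λ : Finset T.Mid =>
    Complex.I • (T.hamiltonian G Λ * A - A * T.hamiltonian G Λ)) atTop (𝓝 D)

/-- Ground states: states with `-i ω(A* δ(A)) ≥ 0` for all local observables `A`. -/
structure IsGroundState (ω : QuasiLocal T.Mid G → ℂ) : Prop where
  isState : IsState ω
  nonneg : ∀ (Λ : Finset T.Mid) (A : QuasiLocal T.Mid G),
    (A : Hilb T.Mid G →L[ℂ] Hilb T.Mid G) ∈ localAlg G (Λ : Set T.Mid) →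
      ∃ D, T.IsDerivation A D ∧ 0 ≤ -Complex.I * ω (star A * D)

/-- Frustration free ground states: states which minimize each of the interaction terms `-A_α` and
`-B_β`. As `A_α` and `B_β` are nonzero projections, the minimal value of each term is `-1`. -/
structure IsFrustrationFree (ω : QuasiLocal T.Mid G → ℂ) : Prop where
  isState : IsState ω
  star : ∀ α, ω (T.starOp G α) = 1
  plaquette : ∀ β, ω (T.plaquetteOp G β) = 1

end CellSystem

open Classical in
/-- `|(supp c)_K|`, the number of cells in the finite set `K` at which the (co)chain `c` is
nonzero. -/
def suppCard {I M : Type*} [Zero M] (c : I → M) (K : Finset I) : ℕ :=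
  (K.filter fun α => c α ≠ 0).card

end KitaevCW

end

open KitaevCW

noncomputable section

namespace KitaevCW

universe u v w

/-! ## Limits of inner automorphisms -/

section Conjugation

variable {𝔄 : Type*} [NormedRing 𝔄] {ι : Type*} [SemilatticeSup ι] [Nonempty ι]

/-! Write `ω = ω₀ ∘ ρ` with `ρ` the endomorphism given by `(γ, δ)`. An expectation value 1 of `A_α`
is an average of expectation values of unitaries, so each unitary in the average must act trivially
in `ω₀` (`map_mul_eq_of_sum_eq`); likewise for `B_β`. On Pauli operators `ρ` only produces phases.
Hence in `ω` the star and plaquette unitaries act by scalars, the charges `∂γ` and `∂ᵀδ`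
(`WeylSystem.hasCharges_comp`).

Applied to the GNS vector of `ω`, a monomial `X^a Z^b` is an eigenvector of every `A_α` and `B_β`.
Orthogonality of characters gives the eigenvalue 1 if the charge of `(γ - b, δ - a)` at that cell
vanishes, and 0 otherwise. So a finite sum of interaction terms has as eigenvalue minus the number
of its uncharged cells. No GNS space is built: an operator identity on the vector is expressed as an
equality of `ω (B * _)` for all `B`.

A local `A` is a finite combination of monomials, and only finitely many interaction terms fail to
commute with it. With `H` the sum of a sufficiently large finite set of terms, `-i ω(A* 𝒟(A)) = ω(A*
(H + v) A)`, where `-v` is the eigenvalue of `H` on the GNS vector itself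
(`HasCharges.map_commutator`). The eigenvalue of `H + v` on a monomial is the number of charges
gained by passing from `(γ, δ)` to `(γ - b, δ - a)`; it equals the limit in condition 1 at `-b` plus
the limit in condition 2 at `-a`.

Testing with `Z^b` or `X^a` alone therefore gives the two conditions (`HasCharges.minimal`).
Conversely, the conditions make all eigenvalues nonnegative. As `H` is self-adjoint, monomials with
different eigenvalues are orthogonal, so the whole quadratic form is nonnegative
(`map_star_mul_mul_nonneg`, `HasCharges.ground`). -/

theorem exists_tendsto_conj [CompleteSpace 𝔄] {U V : ι → 𝔄} (hU : ∀ K, ‖U K‖ ≤ 1)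
    (hV : ∀ K, ‖V K‖ ≤ 1) {D : Set 𝔄} (hD : Dense D)
    (h : ∀ A ∈ D, ∃ B, Tendsto (fun K => U K * A * V K) atTop (𝓝 B)) (A : 𝔄) :
    ∃ B, Tendsto (fun K => U K * A * V K) atTop (𝓝 B) := by
  have hconj : ∀ K B C, dist (U K * B * V K) (U K * C * V K) ≤ dist B C := by
    intro K B C
    rw [dist_eq_norm, dist_eq_norm, ← sub_mul, ← mul_sub]
    calc ‖U K * (B - C) * V K‖ ≤ ‖U K‖ * ‖B - C‖ * ‖V K‖ :=
          (norm_mul_le _ _).trans (by gcongr; exact norm_mul_le _ _)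
      _ ≤ 1 * ‖B - C‖ * 1 := by gcongr <;> simp [hU, hV]
      _ = ‖B - C‖ := by ring
  apply cauchySeq_tendsto_of_complete
  rw [Metric.cauchySeq_iff']
  intro ε hε
  obtain ⟨B, hB, hAB⟩ := hD.exists_dist_lt A (by positivity : 0 < ε / 3)
  obtain ⟨C, hC⟩ := h B hB
  obtain ⟨N, hN⟩ := Metric.cauchySeq_iff'.1 hC.cauchySeq (ε / 3) (by positivity)
  refine ⟨N, fun K hK => ?_⟩
  have h1 := hN K hK
  have h2 := hconj K A B
  have h3 := hconj N B A
  rw [dist_comm B A] at h3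
  have h4 := dist_triangle4 (U K * A * V K) (U K * B * V K) (U N * B * V N) (U N * A * V N)
  linarith

/-- Pointwise convergent conjugations with unitaries converge to an endomorphism. -/
theorem exists_starAlgHom_tendsto_conj [NormedAlgebra ℂ 𝔄] [StarRing 𝔄]
    [ContinuousStar 𝔄] {U V : ι → 𝔄}
    (hUV : ∀ K, U K * V K = 1) (hVU : ∀ K, V K * U K = 1) (hstar : ∀ K, star (U K) = V K)
    (h : ∀ A, ∃ B, Tendsto (fun K => U K * A * V K) atTop (𝓝 B)) :
    ∃ φ : 𝔄 →⋆ₐ[ℂ] 𝔄, ∀ A, Tendsto (fun K => U K * A * V K) atTop (𝓝 (φ A)) := by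
  choose φ hφ using h
  have hone : φ 1 = 1 := tendsto_nhds_unique (hφ 1) (by simp [hUV])
  refine ⟨{ toFun := φ
            map_one' := hone
            map_mul' := fun A B => ?_
            map_zero' := ?_
            map_add' := fun A B => ?_
            commutes' := fun r => ?_
            map_star' := fun A => ?_ }, hφ⟩
  · refine tendsto_nhds_unique (hφ _) (((hφ A).mul (hφ B)).congr fun K => ?_)
    calc U K * A * V K * (U K * B * V K) = U K * A * (V K * U K) * B * V K := by
          simp only [mul_assoc]
      _ = U K * (A * B) * V K := by simp only [hVU, mul_one, mul_assoc]
  · exact tendsto_nhds_unique (hφ 0) (by simp)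
  · refine tendsto_nhds_unique (hφ _) (((hφ A).add (hφ B)).congr fun K => ?_)
    rw [mul_add, add_mul]
  · refine tendsto_nhds_unique (hφ _) (tendsto_const_nhds.congr fun K => ?_)
    rw [← Algebra.commutes r (U K), mul_assoc, hUV, mul_one]
  · refine tendsto_nhds_unique (hφ _) ((hφ A).star.congr fun K => ?_)
    have : star (V K) = U K := by rw [← hstar, star_star]
    rw [star_mul, star_mul, this, hstar, mul_assoc]

end Conjugation

/-! ## Positive functionals -/

section Positive

variable {𝔄 : Type*} [Ring 𝔄] [Algebra ℂ 𝔄] [StarRing 𝔄] [StarModule ℂ 𝔄] {ω : 𝔄 →ₗ[ℂ] ℂ}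

/-- Polarization: the values at `A + 1` and `A + i` are real, which compares the imaginary and the
real parts respectively. -/
theorem map_star_of_nonneg (hω : ∀ A, 0 ≤ ω (star A * A)) (A : 𝔄) :
    ω (star A) = star (ω A) := by
  have h1 := (Complex.nonneg_iff.1 (hω 1)).2
  have hA := (Complex.nonneg_iff.1 (hω A)).2
  have hp := (Complex.nonneg_iff.1 (hω (A + 1))).2
  have hi := (Complex.nonneg_iff.1 (hω (A + Complex.I • 1))).2
  simp [add_mul, mul_add] at h1 hA hp hi
  apply Complex.ext
  · simp; linarith
  · simp; linarith

/-- The Cauchy–Schwarz argument for a null vector: the value at `B + z N` has no term quadratic in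
`z`, so nonnegativity for all `z` forces the linear term to vanish. -/
theorem map_star_mul_eq_zero (hω : ∀ A, 0 ≤ ω (star A * A)) {N : 𝔄} (hN : ω (star N * N) = 0)
    (B : 𝔄) : ω (star B * N) = 0 := by
  have key : ∀ z : ℂ, 0 ≤ (ω (star B * B)).re + 2 * (z * ω (star B * N)).re := by
    intro z
    have h := (Complex.nonneg_iff.1 (hω (B + z • N))).1
    have h2 : ω (star N * B) = star (ω (star B * N)) := by
      rw [← map_star_of_nonneg hω, star_mul, star_star]
    simp [add_mul, mul_add, hN, h2] at h
    simp only [Complex.mul_re]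
    linarith
  set r := (ω (star B * B)).re
  set q := ω (star B * N)
  -- This `z` satisfies `z * q = -(r + 1)`, so the bound becomes `0 ≤ r - 2 * (r + 1)`, which
  -- contradicts `0 ≤ r`.
  have h := key (((-(r + 1) / Complex.normSq q : ℝ) : ℂ) * star q)
  by_contra hq
  have hq' : Complex.normSq q ≠ 0 := by simpa using hq
  have hr : 0 ≤ r := (Complex.nonneg_iff.1 (hω B)).1
  have : ((((-(r + 1) / Complex.normSq q : ℝ) : ℂ) * star q) * q).re = -(r + 1) := by
    rw [mul_assoc, Complex.star_def, ← Complex.normSq_eq_conj_mul_self, ← Complex.ofReal_mul,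
      Complex.ofReal_re, div_mul_cancel₀ _ hq']
  rw [this] at h
  linarith

/-- Unitaries whose expectations average to one act trivially in a state. -/
theorem map_mul_eq_of_sum_eq {κ : Type*} [Fintype κ] (hω : ∀ A, 0 ≤ ω (star A * A))
    (h1 : ω 1 = 1) {U : κ → 𝔄} (hU : ∀ g, star (U g) * U g = 1)
    (h : ∑ g, ω (U g) = Fintype.card κ) (g : κ) (B : 𝔄) : ω (B * U g) = ω B := by
  -- Each summand is `2 - 2 Re ω(U g)` and is nonnegative; a zero total makes every `1 - U g` a null
  -- vector.
  have hs : ∑ g, ω (star (1 - U g) * (1 - U g)) = 0 := by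
    have : ∀ g, ω (star (1 - U g) * (1 - U g)) = 2 - (ω (U g) + star (ω (U g))) := by
      intro g
      rw [star_sub, star_one, sub_mul, mul_sub, mul_sub, hU]
      simp only [one_mul, mul_one, map_sub, h1, map_star_of_nonneg hω]
      ring
    simp_rw [this]
    rw [Finset.sum_sub_distrib, Finset.sum_add_distrib, ← star_sum, h]
    simp
    ring
  have h0 := (Finset.sum_eq_zero_iff_of_nonneg fun g _ => hω (1 - U g)).1 hs g (Finset.mem_univ g)
  have := map_star_mul_eq_zero hω h0 (star B)
  rw [star_star, mul_sub, mul_one, map_sub, sub_eq_zero] at this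
  exact this.symm

/-- A quadratic form with nonnegative eigenvalues is nonnegative. -/
theorem map_star_mul_mul_nonneg {κ : Type*} (hω : ∀ A, 0 ≤ ω (star A * A)) {H : 𝔄}
    (hH : star H = H) {p : κ → 𝔄} {e : κ → ℝ} {s : Finset κ}
    (he : ∀ i ∈ s, 0 ≤ e i) (hp : ∀ i B, ω (B * (H * p i)) = e i * ω (B * p i)) (c : κ → ℂ) :
    0 ≤ ω (star (∑ i ∈ s, c i • p i) * (H * ∑ i ∈ s, c i • p i)) := by
  -- Self-adjointness of `H` lets the eigenvalue be taken from either factor, so different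
  -- eigenvalues mean orthogonality.
  have hsymm : ∀ i j, (e i : ℂ) * ω (star (p i) * p j) = e j * ω (star (p i) * p j) := by
    intro i j
    have h1 : star (star (p j) * (H * p i)) = star (p i) * (H * p j) := by
      rw [star_mul, star_mul, star_star, hH, mul_assoc]
    have h2 : star (star (p j) * p i) = star (p i) * p j := by rw [star_mul, star_star]
    rw [← hp, ← h1, map_star_of_nonneg hω, hp, star_mul', ← map_star_of_nonneg hω, h2]
    simp
  -- Where the inner product is nonzero the two eigenvalues agree. Splitting `e j` as `√(e i) * √(e
  -- j)` turns the form into `ω (star C * C)` for one element `C`.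
  have hsqrt : ∀ i, ∀ j ∈ s, (e j : ℂ) * ω (star (p i) * p j) =
      (√(e i) : ℝ) * ((√(e j) : ℝ) * ω (star (p i) * p j)) := by
    intro i j hj
    by_cases h0 : ω (star (p i) * p j) = 0
    · simp [h0]
    · have h1 : e i = e j := by exact_mod_cast mul_right_cancel₀ h0 (hsymm i j)
      rw [← mul_assoc, h1, ← Complex.ofReal_mul, Real.mul_self_sqrt (he j hj)]
  convert hω (∑ i ∈ s, ((√(e i) : ℝ) * c i : ℂ) • p i) using 1
  simp only [star_sum, star_smul, Finset.sum_mul, Finset.mul_sum, smul_mul_assoc, mul_smul_comm,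
    map_sum, map_smul, smul_eq_mul, hp]
  refine Finset.sum_congr rfl fun j hj => Finset.sum_congr rfl fun i hi => ?_
  rw [hsqrt _ _ (by assumption)]
  simp
  ring

end Positive

/-! ## The pairing of chains and cochains -/

section Pairing

variable {S : Type u} {G : Type v} [AddCommGroup G]

/-- The pairing `∏_σ γ_σ(δ_σ)`. -/
def pairing (γ : S → AddChar G ℂ) (δ : S → G) : ℂ := ∏ᶠ σ, γ σ (δ σ)

theorem pairing_eq_prod_left {γ : S → AddChar G ℂ} {s : Finset S}
    (hs : ∀ σ ∉ s, γ σ = 0) (δ : S → G) : pairing γ δ = ∏ σ ∈ s, γ σ (δ σ) :=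
  finprod_eq_prod_of_mulSupport_subset _ fun σ hσ => by
    by_contra h
    exact hσ (by simp [hs σ h])

theorem pairing_eq_prod_right (γ : S → AddChar G ℂ) {δ : S → G} {s : Finset S}
    (hs : ∀ σ ∉ s, δ σ = 0) : pairing γ δ = ∏ σ ∈ s, γ σ (δ σ) :=
  finprod_eq_prod_of_mulSupport_subset _ fun σ hσ => by
    by_contra h
    exact hσ (by simp [hs σ h])

theorem pairing_ne_zero [Finite G] (γ : S → AddChar G ℂ) (a : S →₀ G) : pairing γ a ≠ 0 := by
  rw [pairing_eq_prod_right γ (s := a.support) (by simp), Finset.prod_ne_zero_iff]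
  exact fun σ _ => ((γ σ).val_isUnit _).ne_zero

theorem finsupp_prod_eq_pairing (b : S →₀ AddChar G ℂ) (δ : S → G) :
    (b.prod fun σ χ => χ (δ σ)) = pairing b δ :=
  (pairing_eq_prod_left (by simp) δ).symm

theorem pairing_add_right (b : S →₀ AddChar G ℂ) (δ δ' : S → G) :
    pairing b (δ + δ') = pairing b δ * pairing b δ' := by
  have hs : ∀ σ ∉ b.support, b σ = 0 := by simp
  simp [pairing_eq_prod_left hs, AddChar.map_add_eq_mul, Finset.prod_mul_distrib]

theorem pairing_add_left (b b' : S →₀ AddChar G ℂ) (δ : S → G) :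
    pairing (b + b') δ = pairing b δ * pairing b' δ := by
  classical
  have hs : ∀ σ ∉ b.support ∪ b'.support, b σ = 0 := by simp +contextual
  have hs' : ∀ σ ∉ b.support ∪ b'.support, b' σ = 0 := by simp +contextual
  have hs'' : ∀ σ ∉ b.support ∪ b'.support, (⇑b + ⇑b') σ = 0 := by simp +contextual
  rw [Finsupp.coe_add, pairing_eq_prod_left hs, pairing_eq_prod_left hs',
    pairing_eq_prod_left hs'']
  simp [AddChar.add_apply, Finset.prod_mul_distrib]

theorem restr_apply_of_mem {M : Type*} [Zero M] (γ : S → M) {K : Finset S} {σ : S} (h : σ ∈ K) :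
    restr γ K σ = γ σ := by
  classical rw [restr, Finsupp.indicator_apply, dif_pos h]

/-- Makes conjugation by `Z^{γ_K}` eventually constant in `K` on each `X^a`. -/
theorem pairing_restr_left (γ : S → AddChar G ℂ) (a : S →₀ G) {K : Finset S}
    (h : a.support ⊆ K) : pairing (restr γ K) a = pairing γ a := by
  rw [pairing_eq_prod_right _ (s := a.support) (by simp),
    pairing_eq_prod_right γ (s := a.support) (by simp)]
  exact Finset.prod_congr rfl fun σ hσ => by rw [restr_apply_of_mem γ (h hσ)]

theorem pairing_restr_right (b : S →₀ AddChar G ℂ) (δ : S → G) {K : Finset S}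
    (h : b.support ⊆ K) : pairing b (restr δ K) = pairing b δ := by
  rw [pairing_eq_prod_left (s := b.support) (by simp),
    pairing_eq_prod_left (s := b.support) (by simp)]
  exact Finset.prod_congr rfl fun σ hσ => by rw [restr_apply_of_mem δ (h hσ)]

end Pairing

/-! ## Boundaries -/

section Boundary

variable {I J M : Type*} [AddCommGroup M] {d : I → J → ℤ} {β : J}

/-- The set `s` depends on the incidence numbers at `β` and not on the chain, so one finite sum
serves infinite chains too and makes linearity available. -/
theorem boundary_eq_sum {s : Finset I} (hs : ∀ α, d α β ≠ 0 → α ∈ s) (c : I → M) :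
    boundary d c β = ∑ α ∈ s, d α β • c α :=
  finsum_eq_sum_of_support_subset _ fun α hα => hs α fun h => hα (by simp [h])

theorem boundary_sub (hd : {α | d α β ≠ 0}.Finite) (c c' : I → M) :
    boundary d (c - c') β = boundary d c β - boundary d c' β := by
  have hs : ∀ α, d α β ≠ 0 → α ∈ hd.toFinset := by simp
  simp [boundary_eq_sum hs, smul_sub]

theorem finite_boundary_ne_zero (hd : ∀ α, {β | d α β ≠ 0}.Finite) (c : I →₀ M) :
    {β | boundary d c β ≠ 0}.Finite := by
  refine (c.support.finite_toSet.biUnion fun α _ => hd α).subset fun β hβ => ?_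
  obtain ⟨α, hα⟩ : ∃ α, d α β • c α ≠ 0 := by
    by_contra! h
    exact hβ (finsum_eq_zero_of_forall_eq_zero h)
  refine mem_iUnion₂.2 ⟨α, ?_, fun h => hα (by simp [h])⟩
  rw [Finset.mem_coe, Finsupp.mem_support_iff]
  exact fun h => hα (by simp [h])

/-- The indicator function of zero. -/
def isVacant (m : M) : ℤ := open Classical in if m = 0 then 1 else 0

/-- Either cardinality may grow without bound, but outside `F` the contributions cancel, so the
difference is constant once `K` contains `F`. Counting zeros in place of nonzero values reverses the
sign, hence the order of `c` and `c'`. -/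
theorem tendsto_suppCard_sub (c c' : I → M) (F : Finset I) (hF : ∀ i, c i ≠ c' i → i ∈ F) :
    Tendsto (fun K : Finset I => (suppCard c' K : ℤ) - suppCard c K) atTop
      (𝓝 (∑ i ∈ F, (isVacant (c i) - isVacant (c' i)))) := by
  classical
  have h : ∀ (c : I → M) (K : Finset I), (suppCard c K : ℤ) = ∑ i ∈ K, (1 - isVacant (c i)) := by
    intro c K
    rw [suppCard, Finset.card_filter, Nat.cast_sum]
    refine Finset.sum_congr rfl fun i _ => ?_
    by_cases hi : c i = 0 <;> simp [isVacant, hi]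
  refine tendsto_const_nhds.congr' ?_
  filter_upwards [eventually_ge_atTop F] with K hK
  rw [h, h, ← Finset.sum_sub_distrib]
  rw [Finset.sum_subset hK fun i _ hi => ?_]
  · exact Finset.sum_congr rfl fun i _ => by ring
  · rw [not_imp_comm.1 (hF i) hi, sub_self]

end Boundary

/-! ## Weyl systems -/

/-- Generalized Pauli operators in a Banach *-algebra. -/
structure WeylRelations (S : Type u) (G : Type v) [AddCommGroup G] (𝔄 : Type w) [NormedRing 𝔄]
    [NormedAlgebra ℂ 𝔄] [StarRing 𝔄] where
  x : (S →₀ G) → 𝔄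
  z : (S →₀ AddChar G ℂ) → 𝔄
  x_zero : x 0 = 1
  x_add : ∀ a a', x (a + a') = x a * x a'
  z_zero : z 0 = 1
  z_add : ∀ b b', z (b + b') = z b * z b'
  star_x : ∀ a, star (x a) = x (-a)
  star_z : ∀ b, star (z b) = z (-b)
  norm_x_le : ∀ a, ‖x a‖ ≤ 1
  norm_z_le : ∀ b, ‖z b‖ ≤ 1
  z_mul_x : ∀ b a, z b * x a = pairing b a • (x a * z b)

namespace WeylRelations

variable {S : Type u} {G : Type v} [AddCommGroup G] {𝔄 : Type w} [NormedRing 𝔄]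
  [NormedAlgebra ℂ 𝔄] [StarRing 𝔄] (W : WeylRelations S G 𝔄)

/-- The span of the generalized Pauli operators. -/
def span : Submodule ℂ 𝔄 :=
  Submodule.span ℂ (range fun p : (S →₀ G) × (S →₀ AddChar G ℂ) => W.x p.1 * W.z p.2)

theorem pauli_mem_span (a : S →₀ G) (b : S →₀ AddChar G ℂ) : W.x a * W.z b ∈ W.span :=
  Submodule.subset_span ⟨(a, b), rfl⟩

theorem z_mul_x_mem_span (b : S →₀ AddChar G ℂ) (a : S →₀ G) : W.z b * W.x a ∈ W.span := by
  rw [W.z_mul_x]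
  exact W.span.smul_mem _ (W.pauli_mem_span a b)

theorem one_mem_span : 1 ∈ W.span := by
  simpa [W.x_zero, W.z_zero] using W.pauli_mem_span 0 0

/-- The commutation relation makes a product of two monomials a scalar multiple of a third. -/
theorem mul_mem_span {A B : 𝔄} (hA : A ∈ W.span) (hB : B ∈ W.span) : A * B ∈ W.span := by
  induction hA using Submodule.span_induction with
  | mem A hA =>
    obtain ⟨⟨a, b⟩, rfl⟩ := hA
    induction hB using Submodule.span_induction with
    | mem B hB =>
      obtain ⟨⟨a', b'⟩, rfl⟩ := hB
      have : W.x a * W.z b * (W.x a' * W.z b') =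
          pairing b a' • (W.x (a + a') * W.z (b + b')) := by
        rw [mul_assoc, ← mul_assoc (W.z b), W.z_mul_x, W.x_add, W.z_add, smul_mul_assoc,
          mul_smul_comm]
        simp only [mul_assoc]
      rw [this]
      exact W.span.smul_mem _ (W.pauli_mem_span _ _)
    | zero => simp
    | add B C _ _ hB hC =>
      rw [mul_add]
      exact add_mem hB hC
    | smul c B _ hB =>
      rw [mul_smul_comm]
      exact W.span.smul_mem c hB
  | zero => simp
  | add A C _ _ hA hC =>
    rw [add_mul]
    exact add_mem hA hC
  | smul c A _ hA =>
    rw [smul_mul_assoc]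
    exact W.span.smul_mem c hA

theorem star_mem_span [StarModule ℂ 𝔄] {A : 𝔄} (hA : A ∈ W.span) : star A ∈ W.span := by
  induction hA using Submodule.span_induction with
  | mem A hA =>
    obtain ⟨⟨a, b⟩, rfl⟩ := hA
    rw [star_mul, W.star_x, W.star_z]
    exact W.z_mul_x_mem_span _ _
  | zero => simp
  | add A C _ _ hA hC =>
    rw [star_add]
    exact add_mem hA hC
  | smul c A _ hA =>
    rw [star_smul]
    exact W.span.smul_mem _ hA

end WeylRelations

/-- Generalized Pauli operators which generate a Banach *-algebra. -/
structure WeylSystem (S : Type u) (G : Type v) [AddCommGroup G] (𝔄 : Type w) [NormedRing 𝔄]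
    [NormedAlgebra ℂ 𝔄] [StarRing 𝔄] extends WeylRelations S G 𝔄 where
  dense : Dense (toWeylRelations.span : Set 𝔄)

namespace WeylSystem

variable {S : Type u} {G : Type v} [AddCommGroup G] {𝔄 : Type w} [NormedRing 𝔄]
  [NormedAlgebra ℂ 𝔄] [StarRing 𝔄] (W : WeylSystem S G 𝔄)

theorem x_mul_x_neg (a : S →₀ G) : W.x a * W.x (-a) = 1 := by
  rw [← W.x_add, add_neg_cancel, W.x_zero]

theorem x_neg_mul_x (a : S →₀ G) : W.x (-a) * W.x a = 1 := by
  rw [← W.x_add, neg_add_cancel, W.x_zero]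

theorem z_mul_z_neg (b : S →₀ AddChar G ℂ) : W.z b * W.z (-b) = 1 := by
  rw [← W.z_add, show b + -b = 0 from add_neg_cancel b, W.z_zero]

theorem z_neg_mul_z (b : S →₀ AddChar G ℂ) : W.z (-b) * W.z b = 1 := by
  rw [← W.z_add, show -b + b = 0 from neg_add_cancel b, W.z_zero]

theorem commute_x (a a' : S →₀ G) : Commute (W.x a) (W.x a') := by
  rw [Commute, SemiconjBy, ← W.x_add, add_comm, W.x_add]

theorem commute_z (b b' : S →₀ AddChar G ℂ) : Commute (W.z b) (W.z b') := by
  rw [Commute, SemiconjBy, ← W.z_add, show b + b' = b' + b from add_comm b b', W.z_add]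

theorem x_mul_z [Finite G] (a : S →₀ G) (b : S →₀ AddChar G ℂ) :
    W.x a * W.z b = (pairing b a)⁻¹ • (W.z b * W.x a) := by
  rw [W.z_mul_x, inv_smul_smul₀ (pairing_ne_zero _ _)]

theorem x_mul_pauli [Finite G] (s a : S →₀ G) (b : S →₀ AddChar G ℂ) :
    W.x s * (W.x a * W.z b) = (pairing b s)⁻¹ • (W.x a * W.z b * W.x s) := by
  rw [← mul_assoc, (W.commute_x s a).eq, mul_assoc, W.x_mul_z, mul_smul_comm, mul_assoc]

theorem z_mul_pauli (t : S →₀ AddChar G ℂ) (a : S →₀ G) (b : S →₀ AddChar G ℂ) :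
    W.z t * (W.x a * W.z b) = pairing t a • (W.x a * W.z b * W.z t) := by
  rw [← mul_assoc, W.z_mul_x, smul_mul_assoc, mul_assoc, (W.commute_z t b).eq, ← mul_assoc]

/-! ### Conjugation by infinite products of Pauli operators. -/

section Automorphisms

variable [CompleteSpace 𝔄] [ContinuousStar 𝔄]

/-- Inserting `V K * U K = 1` between the factors of a monomial reduces convergence to the
generators; linearity and density do the rest. -/
theorem exists_conj {U V : Finset S → 𝔄} (hU : ∀ K, ‖U K‖ ≤ 1) (hV : ∀ K, ‖V K‖ ≤ 1)
    (hUV : ∀ K, U K * V K = 1) (hVU : ∀ K, V K * U K = 1) (hstar : ∀ K, star (U K) = V K)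
    (hx : ∀ a, ∃ B, Tendsto (fun K => U K * W.x a * V K) atTop (𝓝 B))
    (hz : ∀ b, ∃ B, Tendsto (fun K => U K * W.z b * V K) atTop (𝓝 B)) :
    ∃ φ : 𝔄 →⋆ₐ[ℂ] 𝔄, ∀ A, Tendsto (fun K => U K * A * V K) atTop (𝓝 (φ A)) := by
  classical
  refine exists_starAlgHom_tendsto_conj hUV hVU hstar
    (exists_tendsto_conj hU hV W.dense fun A hA => ?_)
  induction hA using Submodule.span_induction with
  | mem A hA =>
    obtain ⟨⟨a, b⟩, rfl⟩ := hA
    obtain ⟨B, hB⟩ := hx a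
    obtain ⟨C, hC⟩ := hz b
    refine ⟨B * C, (hB.mul hC).congr fun K => ?_⟩
    calc U K * W.x a * V K * (U K * W.z b * V K) =
          U K * W.x a * (V K * U K) * W.z b * V K := by simp only [mul_assoc]
      _ = U K * (W.x a * W.z b) * V K := by simp only [hVU, mul_one, mul_assoc]
  | zero => exact ⟨0, by simp⟩
  | add A A' _ _ hA hA' =>
    obtain ⟨B, hB⟩ := hA
    obtain ⟨B', hB'⟩ := hA'
    exact ⟨B + B', by simpa only [mul_add, add_mul] using hB.add hB'⟩
  | smul c A _ hA =>
    obtain ⟨B, hB⟩ := hA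
    exact ⟨c • B, by simpa only [mul_smul_comm, smul_mul_assoc] using hB.const_smul c⟩

theorem exists_conj_z (γ : S → AddChar G ℂ) : ∃ φ : 𝔄 →⋆ₐ[ℂ] 𝔄,
    (∀ A, Tendsto (fun K : Finset S => W.z (restr γ K) * A * W.z (-restr γ K)) atTop (𝓝 (φ A))) ∧
    (∀ a, φ (W.x a) = pairing γ a • W.x a) ∧ ∀ b, φ (W.z b) = W.z b := by
  have hx : ∀ a, Tendsto (fun K : Finset S => W.z (restr γ K) * W.x a * W.z (-restr γ K)) atTop
      (𝓝 (pairing γ a • W.x a)) := fun a => tendsto_const_nhds.congr' <| by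
    filter_upwards [eventually_ge_atTop a.support] with K hK
    rw [W.z_mul_x, smul_mul_assoc, mul_assoc, W.z_mul_z_neg, mul_one, pairing_restr_left γ a hK]
  have hz : ∀ b, Tendsto (fun K : Finset S => W.z (restr γ K) * W.z b * W.z (-restr γ K)) atTop
      (𝓝 (W.z b)) := fun b => tendsto_const_nhds.congr fun K => by
    rw [(W.commute_z _ b).eq, mul_assoc, W.z_mul_z_neg, mul_one]
  obtain ⟨φ, hφ⟩ := W.exists_conj (fun K => W.norm_z_le (restr γ K)) (fun K => W.norm_z_le _)
    (fun K => W.z_mul_z_neg _) (fun K => W.z_neg_mul_z _) (fun K => W.star_z _)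
    (fun a => ⟨_, hx a⟩) (fun b => ⟨_, hz b⟩)
  exact ⟨φ, hφ, fun a => tendsto_nhds_unique (hφ _) (hx a),
    fun b => tendsto_nhds_unique (hφ _) (hz b)⟩

theorem exists_conj_x [Finite G] (δ : S → G) : ∃ φ : 𝔄 →⋆ₐ[ℂ] 𝔄,
    (∀ A, Tendsto (fun K : Finset S => W.x (restr δ K) * A * W.x (-restr δ K)) atTop (𝓝 (φ A))) ∧
    (∀ a, φ (W.x a) = W.x a) ∧ ∀ b, φ (W.z b) = (pairing b δ)⁻¹ • W.z b := by
  have hx : ∀ a, Tendsto (fun K : Finset S => W.x (restr δ K) * W.x a * W.x (-restr δ K)) atTop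
      (𝓝 (W.x a)) := fun a => tendsto_const_nhds.congr fun K => by
    rw [(W.commute_x _ a).eq, mul_assoc, W.x_mul_x_neg, mul_one]
  have hz : ∀ b, Tendsto (fun K : Finset S => W.x (restr δ K) * W.z b * W.x (-restr δ K)) atTop
      (𝓝 ((pairing b δ)⁻¹ • W.z b)) := fun b => tendsto_const_nhds.congr' <| by
    filter_upwards [eventually_ge_atTop b.support] with K hK
    rw [W.x_mul_z, smul_mul_assoc, mul_assoc, W.x_mul_x_neg, mul_one, pairing_restr_right b δ hK]
  obtain ⟨φ, hφ⟩ := W.exists_conj (fun K => W.norm_x_le (restr δ K)) (fun K => W.norm_x_le _)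
    (fun K => W.x_mul_x_neg _) (fun K => W.x_neg_mul_x _) (fun K => W.star_x _)
    (fun a => ⟨_, hx a⟩) (fun b => ⟨_, hz b⟩)
  exact ⟨φ, hφ, fun a => tendsto_nhds_unique (hφ _) (hx a),
    fun b => tendsto_nhds_unique (hφ _) (hz b)⟩

end Automorphisms

end WeylSystem

/-! ## Stars and plaquettes -/

theorem addChar_map_sum {ι A M : Type*} [AddCommMonoid A] [CommMonoid M] (χ : AddChar A M)
    (s : Finset ι) (f : ι → A) : χ (∑ i ∈ s, f i) = ∏ i ∈ s, χ (f i) := by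
  classical
  induction s using Finset.induction_on with
  | empty => simp
  | insert i s hi ih => rw [Finset.sum_insert hi, Finset.prod_insert hi, χ.map_add_eq_mul, ih]

namespace CellSystem

variable (T : CellSystem.{u}) {G : Type v} [AddCommGroup G]

theorem starCochain_apply (α : T.Low) (g : G) (σ : T.Mid) :
    T.starCochain α g σ = T.dLow σ α • g := by
  classical
  convert coboundary_single T.dLow α g σ
  change coboundary T.dLow _ σ = _
  congr!

theorem plaquetteChain_apply (β : T.High) (χ : AddChar G ℂ) (σ : T.Mid) :
    T.plaquetteChain β χ σ = T.dHigh β σ • χ := by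
  classical
  convert boundary_single T.dHigh β χ σ
  change boundary T.dHigh _ σ = _
  congr!

theorem starCochain_neg (α : T.Low) (g : G) : T.starCochain α (-g) = -T.starCochain α g := by
  ext σ
  simp [starCochain_apply]

theorem plaquetteChain_neg (β : T.High) (χ : AddChar G ℂ) :
    T.plaquetteChain β (-χ) = -T.plaquetteChain β χ := by
  ext σ : 1
  simp [plaquetteChain_apply]

/-- The operators `∂` and `∂ᵀ` are adjoint for the pairing. This turns commutation phases of star
unitaries into values of a boundary. -/
theorem pairing_starCochain (γ : T.Mid → AddChar G ℂ) (α : T.Low) (g : G) :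
    pairing γ (T.starCochain α g) = boundary T.dLow γ α g := by
  have hs : ∀ σ, T.dLow σ α ≠ 0 → σ ∈ (T.finite_dLow_right α).toFinset := by simp
  rw [boundary_eq_sum hs, pairing_eq_prod_right γ (s := (T.finite_dLow_right α).toFinset),
    AddChar.sum_apply]
  · simp [starCochain_apply, AddChar.zsmul_apply, AddChar.map_zsmul_eq_zpow]
  · intro σ hσ
    rw [starCochain_apply, not_not.1 (mt (hs σ) hσ), zero_zsmul]

theorem pairing_plaquetteChain (β : T.High) (χ : AddChar G ℂ) (δ : T.Mid → G) :
    pairing (T.plaquetteChain β χ) δ = χ (coboundary T.dHigh δ β) := by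
  have hs : ∀ σ, T.dHigh β σ ≠ 0 → σ ∈ (T.finite_dHigh_left β).toFinset := by simp
  change _ = χ (boundary (fun σ β => T.dHigh β σ) δ β)
  rw [boundary_eq_sum hs, pairing_eq_prod_left (s := (T.finite_dHigh_left β).toFinset),
    addChar_map_sum]
  · simp [plaquetteChain_apply, AddChar.zsmul_apply, AddChar.map_zsmul_eq_zpow]
  · intro σ hσ
    rw [plaquetteChain_apply, not_not.1 (mt (hs σ) hσ), zero_zsmul]

theorem starSupp_finite (α : T.Low) : (T.starSupp G α).Finite := by
  refine (T.finite_dLow_right α).subset fun σ ⟨g, hg⟩ h => hg ?_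
  rw [starCochain_apply, h, zero_zsmul]

theorem plaquetteSupp_finite (β : T.High) : (T.plaquetteSupp G β).Finite := by
  refine (T.finite_dHigh_left β).subset fun σ ⟨g, hg⟩ h => hg ?_
  rw [plaquetteChain_apply, h, zero_zsmul]

/-- A star with empty support has only trivial cochains, and their pairing with `b` is 1. So the
terms left out of the Hamiltonian never detect a charge. -/
theorem starSupp_nonempty {b : T.Mid → AddChar G ℂ} {α : T.Low}
    (h : boundary T.dLow b α ≠ 0) : (T.starSupp G α).Nonempty := by
  by_contra h0
  apply h
  rw [AddChar.eq_zero_iff]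
  intro g
  have : T.starCochain α g = 0 := by
    ext σ
    by_contra hσ
    exact h0 ⟨σ, g, hσ⟩
  rw [← pairing_starCochain, this, pairing_eq_prod_right b (s := ∅) (by simp), Finset.prod_empty]

/-- The dual argument also needs that the characters of a finite group separate points. -/
theorem plaquetteSupp_nonempty [Finite G] {a : T.Mid → G} {β : T.High}
    (h : coboundary T.dHigh a β ≠ 0) : (T.plaquetteSupp G β).Nonempty := by
  by_contra h0
  obtain ⟨χ, hχ⟩ := AddChar.exists_apply_ne_zero.2 h
  apply hχ
  have : T.plaquetteChain β χ = 0 := by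
    ext σ : 1
    by_contra hσ
    exact h0 ⟨σ, χ, hσ⟩
  rw [← pairing_plaquetteChain, this, pairing_eq_prod_left (s := ∅) (by simp), Finset.prod_empty]

theorem eventually_subset_starsIn (F : Set T.Low) (hF : F.Finite)
    (h : ∀ α ∈ F, (T.starSupp G α).Nonempty) : ∀ᶠ Λ in atTop, F ⊆ T.starsIn G Λ := by
  filter_upwards [eventually_ge_atTop (hF.biUnion fun α _ => T.starSupp_finite (G := G) α).toFinset]
    with Λ hΛ α hα
  exact ⟨h α hα, fun σ hσ => hΛ (by simpa using ⟨α, hα, hσ⟩)⟩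

theorem eventually_subset_plaquettesIn (F : Set T.High) (hF : F.Finite)
    (h : ∀ β ∈ F, (T.plaquetteSupp G β).Nonempty) : ∀ᶠ Λ in atTop, F ⊆ T.plaquettesIn G Λ := by
  filter_upwards
    [eventually_ge_atTop (hF.biUnion fun β _ => T.plaquetteSupp_finite (G := G) β).toFinset]
    with Λ hΛ β hβ
  exact ⟨h β hβ, fun σ hσ => hΛ (by simpa using ⟨β, hβ, hσ⟩)⟩

end CellSystem

/-! ## The number of the charges -/

section Charges

variable {T : CellSystem.{u}} {G : Type v} [AddCommGroup G] {γ : T.Mid → AddChar G ℂ}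
  {δ : T.Mid → G}

/-- The number of the given stars and plaquettes without charge. -/
def vacancies (γ : T.Mid → AddChar G ℂ) (δ : T.Mid → G) (F : Finset T.Low) (F' : Finset T.High) :
    ℤ :=
  ∑ α ∈ F, isVacant (boundary T.dLow γ α) + ∑ β ∈ F', isVacant (coboundary T.dHigh δ β)

theorem vacancies_sub (γ' : T.Mid → AddChar G ℂ) (δ' : T.Mid → G) (F : Finset T.Low)
    (F' : Finset T.High) : vacancies γ δ F F' - vacancies γ' δ' F F' =
      ∑ α ∈ F, (isVacant (boundary T.dLow γ α) - isVacant (boundary T.dLow γ' α)) +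
        ∑ β ∈ F', (isVacant (coboundary T.dHigh δ β) - isVacant (coboundary T.dHigh δ' β)) := by
  simp only [vacancies, Finset.sum_sub_distrib]
  ring

/-- A coboundary is by definition the boundary for the transposed incidence numbers, so results on
boundaries carry over. -/
theorem coboundary_sub (β : T.High) (δ' : T.Mid → G) :
    coboundary T.dHigh (δ - δ') β = coboundary T.dHigh δ β - coboundary T.dHigh δ' β :=
  boundary_sub (d := fun σ β => T.dHigh β σ) (T.finite_dHigh_left β) δ δ'

theorem finite_coboundary_ne_zero (a : T.Mid →₀ G) : {β | coboundary T.dHigh a β ≠ 0}.Finite :=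
  finite_boundary_ne_zero (d := fun σ β => T.dHigh β σ) T.finite_dHigh_right a

/-- The sign in `γ - b` is the one produced by moving star unitaries past `X^a Z^b`. The two
boundaries agree wherever that of `b` vanishes, so any `F` containing the support of the latter will
do. -/
theorem tendsto_suppCard_boundary (b : T.Mid →₀ AddChar G ℂ) {F : Finset T.Low}
    (hF : ∀ α, boundary T.dLow b α ≠ 0 → α ∈ F) :
    Tendsto (fun K : Finset T.Low => (suppCard (boundary T.dLow (γ - ⇑b)) K : ℤ) -
      suppCard (boundary T.dLow γ) K) atTop (𝓝 (∑ α ∈ F, (isVacant (boundary T.dLow γ α) -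
        isVacant (boundary T.dLow (γ - ⇑b) α)))) :=
  tendsto_suppCard_sub _ _ F fun α hα => hF α fun h0 => hα <| by
    rw [boundary_sub (T.finite_dLow_right α), h0, sub_zero]

theorem tendsto_suppCard_coboundary (a : T.Mid →₀ G) {F : Finset T.High}
    (hF : ∀ β, coboundary T.dHigh a β ≠ 0 → β ∈ F) :
    Tendsto (fun K : Finset T.High => (suppCard (coboundary T.dHigh (δ - ⇑a)) K : ℤ) -
      suppCard (coboundary T.dHigh δ) K) atTop (𝓝 (∑ β ∈ F, (isVacant (coboundary T.dHigh δ β) -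
        isVacant (coboundary T.dHigh (δ - ⇑a) β)))) :=
  tendsto_suppCard_sub _ _ F fun β hβ => hF β fun h0 => hβ <| by
    rw [coboundary_sub, h0, sub_zero]

variable (γ) in
/-- The number of the charged stars does not decrease under local changes of `γ`. -/
def StarMinimal : Prop := ∀ b : T.Mid →₀ AddChar G ℂ, ∃ L : ℤ,
  Tendsto (fun K : Finset T.Low => (suppCard (boundary T.dLow (γ + ⇑b)) K : ℤ) -
    suppCard (boundary T.dLow γ) K) atTop (𝓝 L) ∧ 0 ≤ L

variable (δ) in
/-- The number of the charged plaquettes does not decrease under local changes of `δ`. -/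
def PlaquetteMinimal : Prop := ∀ a : T.Mid →₀ G, ∃ L : ℤ,
  Tendsto (fun K : Finset T.High => (suppCard (coboundary T.dHigh (δ + ⇑a)) K : ℤ) -
    suppCard (coboundary T.dHigh δ) K) atTop (𝓝 L) ∧ 0 ≤ L

/-- Minimality is stated for `γ + b` and the eigenvalues involve `γ - b`, so it is used at `-b`. -/
theorem StarMinimal.sum_nonneg (h : StarMinimal γ) (b : T.Mid →₀ AddChar G ℂ) {F : Finset T.Low}
    (hF : ∀ α, boundary T.dLow b α ≠ 0 → α ∈ F) :
    0 ≤ ∑ α ∈ F, (isVacant (boundary T.dLow γ α) - isVacant (boundary T.dLow (γ - ⇑b) α)) := by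
  obtain ⟨L, hL, h0⟩ := h (-b)
  have hb : γ + ⇑(-b) = γ - ⇑b := (sub_eq_add_neg γ ⇑b).symm
  rw [hb] at hL
  rwa [tendsto_nhds_unique (tendsto_suppCard_boundary b hF) hL]

theorem PlaquetteMinimal.sum_nonneg (h : PlaquetteMinimal δ) (a : T.Mid →₀ G) {F : Finset T.High}
    (hF : ∀ β, coboundary T.dHigh a β ≠ 0 → β ∈ F) : 0 ≤ ∑ β ∈ F,
      (isVacant (coboundary T.dHigh δ β) - isVacant (coboundary T.dHigh (δ - ⇑a) β)) := by
  obtain ⟨L, hL, h0⟩ := h (-a)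
  have ha : δ + ⇑(-a) = δ - ⇑a := (sub_eq_add_neg δ ⇑a).symm
  rw [ha] at hL
  rwa [tendsto_nhds_unique (tendsto_suppCard_coboundary a hF) hL]

theorem starMinimal_of_sum_nonneg (h : ∀ b : T.Mid →₀ AddChar G ℂ, ∃ F : Finset T.Low,
    (∀ α, boundary T.dLow b α ≠ 0 → α ∈ F) ∧
      0 ≤ ∑ α ∈ F, (isVacant (boundary T.dLow γ α) - isVacant (boundary T.dLow (γ - ⇑b) α))) :
    StarMinimal γ := by
  intro b
  obtain ⟨F, hF, h0⟩ := h (-b)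
  have hb : γ - ⇑(-b) = γ + ⇑b := sub_neg_eq_add γ ⇑b
  exact ⟨_, hb ▸ tendsto_suppCard_boundary (-b) hF, h0⟩

theorem plaquetteMinimal_of_sum_nonneg (h : ∀ a : T.Mid →₀ G, ∃ F : Finset T.High,
    (∀ β, coboundary T.dHigh a β ≠ 0 → β ∈ F) ∧ 0 ≤ ∑ β ∈ F,
      (isVacant (coboundary T.dHigh δ β) - isVacant (coboundary T.dHigh (δ - ⇑a) β))) :
    PlaquetteMinimal δ := by
  intro a
  obtain ⟨F, hF, h0⟩ := h (-a)
  have ha : δ - ⇑(-a) = δ + ⇑a := sub_neg_eq_add δ ⇑a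
  exact ⟨_, ha ▸ tendsto_suppCard_coboundary (-a) hF, h0⟩

end Charges

/-! ## The Hamiltonian of a Weyl system -/

namespace WeylSystem

variable {T : CellSystem.{u}} {G : Type v} [AddCommGroup G] [Fintype G] {𝔄 : Type w}
  [NormedRing 𝔄] [NormedAlgebra ℂ 𝔄] [StarRing 𝔄] (W : WeylSystem T.Mid G 𝔄)

/-- The star operators. -/
def starOp (α : T.Low) : 𝔄 := (Fintype.card G : ℂ)⁻¹ • ∑ g : G, W.x (T.starCochain α g)

/-- The plaquette operators. -/
def plaquetteOp (β : T.High) : 𝔄 :=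
  (Fintype.card G : ℂ)⁻¹ • ∑ χ : AddChar G ℂ, W.z (T.plaquetteChain β χ)

/-- Minus the sum of the given star and plaquette operators. -/
def hamiltonian (F : Finset T.Low) (F' : Finset T.High) : 𝔄 :=
  -(∑ α ∈ F, W.starOp α) - ∑ β ∈ F', W.plaquetteOp β

theorem star_starOp [StarModule ℂ 𝔄] (α : T.Low) : star (W.starOp α) = W.starOp α := by
  simp only [starOp, star_smul, star_sum, W.star_x, ← T.starCochain_neg]
  congr 1
  · simp
  · exact Equiv.sum_comp (Equiv.neg G) fun g => W.x (T.starCochain α g)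

theorem star_plaquetteOp [StarModule ℂ 𝔄] (β : T.High) :
    star (W.plaquetteOp β) = W.plaquetteOp β := by
  simp only [plaquetteOp, star_smul, star_sum, W.star_z, ← T.plaquetteChain_neg]
  congr 1
  · simp
  · exact Equiv.sum_comp (Equiv.neg (AddChar G ℂ)) fun χ => W.z (T.plaquetteChain β χ)

theorem star_hamiltonian [StarModule ℂ 𝔄] (F : Finset T.Low) (F' : Finset T.High) :
    star (W.hamiltonian F F') = W.hamiltonian F F' := by
  simp only [hamiltonian, star_sub, star_neg, star_sum, star_starOp, star_plaquetteOp]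

/-! ### Commutators with Pauli operators -/

theorem commute_starOp {b : T.Mid →₀ AddChar G ℂ} {α : T.Low} (h : boundary T.dLow b α = 0)
    (a : T.Mid →₀ G) : Commute (W.starOp α) (W.x a * W.z b) := by
  refine Commute.smul_left (Commute.sum_left _ _ _ fun g _ => ?_) _
  rw [Commute, SemiconjBy, W.x_mul_pauli, T.pairing_starCochain, h, AddChar.zero_apply, inv_one,
    one_smul]

theorem commute_plaquetteOp {a : T.Mid →₀ G} {β : T.High} (h : coboundary T.dHigh a β = 0)
    (b : T.Mid →₀ AddChar G ℂ) : Commute (W.plaquetteOp β) (W.x a * W.z b) := by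
  refine Commute.smul_left (Commute.sum_left _ _ _ fun χ _ => ?_) _
  rw [Commute, SemiconjBy, W.z_mul_pauli, T.pairing_plaquetteChain, h, AddChar.map_zero_eq_one,
    one_smul]

theorem hamiltonian_commutator (F : Finset T.Low) (F' : Finset T.High) (A : 𝔄) :
    W.hamiltonian F F' * A - A * W.hamiltonian F F' =
      -(∑ α ∈ F, (W.starOp α * A - A * W.starOp α)) -
        ∑ β ∈ F', (W.plaquetteOp β * A - A * W.plaquetteOp β) := by
  simp only [hamiltonian, sub_mul, mul_sub, neg_mul, mul_neg, Finset.sum_mul, Finset.mul_sum,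
    Finset.sum_sub_distrib]
  abel

/-- Only finitely many terms of the Hamiltonian contribute to the commutator with an element of
the span of the Pauli operators. -/
theorem exists_hamiltonian_commutator {A : 𝔄} (hA : A ∈ W.span) :
    ∃ (L : Finset T.Low) (L' : Finset T.High), (∀ α ∈ L, (T.starSupp G α).Nonempty) ∧
      (∀ β ∈ L', (T.plaquetteSupp G β).Nonempty) ∧ ∀ F F', L ⊆ F → L' ⊆ F' →
        W.hamiltonian F F' * A - A * W.hamiltonian F F' =
          W.hamiltonian L L' * A - A * W.hamiltonian L L' := by
  classical
  -- Commuting with every term outside a finite set is stable under linear combinations, by taking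
  -- unions of the sets, so only monomials need an argument.
  suffices h : ∃ (L : Finset T.Low) (L' : Finset T.High), (∀ α ∈ L, (T.starSupp G α).Nonempty) ∧
      (∀ β ∈ L', (T.plaquetteSupp G β).Nonempty) ∧ (∀ α ∉ L, Commute (W.starOp α) A) ∧
      ∀ β ∉ L', Commute (W.plaquetteOp β) A by
    obtain ⟨L, L', h1, h2, h3, h4⟩ := h
    refine ⟨L, L', h1, h2, fun F F' hF hF' => ?_⟩
    rw [hamiltonian_commutator, hamiltonian_commutator,
      Finset.sum_subset hF fun α _ hα => by rw [(h3 α hα).eq, sub_self],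
      Finset.sum_subset hF' fun β _ hβ => by rw [(h4 β hβ).eq, sub_self]]
  induction hA using Submodule.span_induction with
  | mem A hA =>
    obtain ⟨⟨a, b⟩, rfl⟩ := hA
    have hb := finite_boundary_ne_zero (M := AddChar G ℂ) T.finite_dLow_left b
    have ha := finite_coboundary_ne_zero a
    refine ⟨hb.toFinset, ha.toFinset, fun α hα => ?_, fun β hβ => ?_, fun α hα => ?_,
      fun β hβ => ?_⟩
    · exact T.starSupp_nonempty (by simpa using hα)
    · exact T.plaquetteSupp_nonempty (by simpa using hβ)
    · exact W.commute_starOp (by simpa using hα) a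
    · exact W.commute_plaquetteOp (by simpa using hβ) b
  | zero => exact ⟨∅, ∅, by simp⟩
  | add A B _ _ hA hB =>
    obtain ⟨L, L', h1, h2, h3, h4⟩ := hA
    obtain ⟨M, M', k1, k2, k3, k4⟩ := hB
    refine ⟨L ∪ M, L' ∪ M', fun α hα => ?_, fun β hβ => ?_, fun α hα => ?_, fun β hβ => ?_⟩
    · exact (Finset.mem_union.1 hα).elim (h1 α) (k1 α)
    · exact (Finset.mem_union.1 hβ).elim (h2 β) (k2 β)
    · rw [Finset.mem_union, not_or] at hα
      exact (h3 α hα.1).add_right (k3 α hα.2)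
    · rw [Finset.mem_union, not_or] at hβ
      exact (h4 β hβ.1).add_right (k4 β hβ.2)
  | smul c A _ hA =>
    obtain ⟨L, L', h1, h2, h3, h4⟩ := hA
    exact ⟨L, L', h1, h2, fun α hα => (h3 α hα).smul_right c, fun β hβ => (h4 β hβ).smul_right c⟩

/-- The commutator of `i H_Λ` and `A`. -/
def commutator (A : 𝔄) (Λ : Finset T.Mid) : 𝔄 :=
  Complex.I • (W.hamiltonian (T.finite_starsIn (G := G) Λ).toFinset
      (T.finite_plaquettesIn (G := G) Λ).toFinset * A -
    A * W.hamiltonian (T.finite_starsIn (G := G) Λ).toFinset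
      (T.finite_plaquettesIn (G := G) Λ).toFinset)

/-- The derivation is defined on the span of the Pauli operators. -/
theorem exists_tendsto_commutator {A : 𝔄} (hA : A ∈ W.span) :
    ∃ (L : Finset T.Low) (L' : Finset T.High), (∀ F F', L ⊆ F → L' ⊆ F' →
        W.hamiltonian F F' * A - A * W.hamiltonian F F' =
          W.hamiltonian L L' * A - A * W.hamiltonian L L') ∧
      Tendsto (W.commutator A) atTop
        (𝓝 (Complex.I • (W.hamiltonian L L' * A - A * W.hamiltonian L L'))) := by
  obtain ⟨L, L', h1, h2, h3⟩ := W.exists_hamiltonian_commutator hA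
  refine ⟨L, L', h3, tendsto_const_nhds.congr' ?_⟩
  -- The Hamiltonian of `Λ` omits terms with empty support, so `L` and `L'` are eventually covered
  -- only because their members have nonempty support.
  filter_upwards [T.eventually_subset_starsIn (G := G) L L.finite_toSet h1,
    T.eventually_subset_plaquettesIn (G := G) L' L'.finite_toSet h2] with Λ hΛ hΛ'
  rw [commutator, h3 (T.finite_starsIn Λ).toFinset (T.finite_plaquettesIn Λ).toFinset (by simpa using hΛ)
    (by simpa using hΛ')]

/-! ### Eigenvectors of the Hamiltonian -/

/-- Functionals with definite charges. -/
structure HasCharges (ω : 𝔄 →ₗ[ℂ] ℂ) (γ : T.Mid → AddChar G ℂ) (δ : T.Mid → G) : Prop where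
  map_star : ∀ α g B, ω (B * W.x (T.starCochain α g)) = boundary T.dLow γ α g * ω B
  map_plaquette : ∀ β χ B, ω (B * W.z (T.plaquetteChain β χ)) = (χ (coboundary T.dHigh δ β))⁻¹ * ω B

variable {W} {ω : 𝔄 →ₗ[ℂ] ℂ} {γ : T.Mid → AddChar G ℂ} {δ : T.Mid → G}

/-- Moving a star unitary to the right past the monomial costs the inverse of the boundary of `b`,
and at the right end it yields the boundary of `γ`. The average over `g` is then that of the
character `∂(γ - b)_α`, which is 1 or 0 by orthogonality. -/
theorem HasCharges.map_starOp_mul (h : W.HasCharges ω γ δ) (α : T.Low) (a : T.Mid →₀ G)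
    (b : T.Mid →₀ AddChar G ℂ) (B : 𝔄) : ω (B * (W.starOp α * (W.x a * W.z b))) =
      isVacant (boundary T.dLow (γ - ⇑b) α) * ω (B * (W.x a * W.z b)) := by
  classical
  have key : ∀ g, ω (B * (W.x (T.starCochain α g) * (W.x a * W.z b))) =
      boundary T.dLow (γ - ⇑b) α g * ω (B * (W.x a * W.z b)) := by
    intro g
    rw [W.x_mul_pauli, mul_smul_comm, map_smul, ← mul_assoc, h.map_star, T.pairing_starCochain,
      boundary_sub (T.finite_dLow_right α), AddChar.sub_apply, smul_eq_mul,
      AddChar.map_neg_eq_inv]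
    ring
  simp only [starOp, smul_mul_assoc, mul_smul_comm, map_smul, Finset.sum_mul, Finset.mul_sum,
    map_sum, key, smul_eq_mul]
  rw [← Finset.mul_sum, ← Finset.sum_mul, AddChar.sum_eq_ite, ← mul_assoc]
  congr 1
  by_cases h0 : boundary T.dLow (γ - ⇑b) α = 0 <;> simp [isVacant, h0]

/-- The dual computation: a fixed group element is averaged over all characters. -/
theorem HasCharges.map_plaquetteOp_mul (h : W.HasCharges ω γ δ) (β : T.High) (a : T.Mid →₀ G)
    (b : T.Mid →₀ AddChar G ℂ) (B : 𝔄) : ω (B * (W.plaquetteOp β * (W.x a * W.z b))) =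
      isVacant (coboundary T.dHigh (δ - ⇑a) β) * ω (B * (W.x a * W.z b)) := by
  classical
  have key : ∀ χ, ω (B * (W.z (T.plaquetteChain β χ) * (W.x a * W.z b))) =
      χ (-coboundary T.dHigh (δ - ⇑a) β) * ω (B * (W.x a * W.z b)) := by
    intro χ
    rw [W.z_mul_pauli, mul_smul_comm, map_smul, ← mul_assoc, h.map_plaquette, T.pairing_plaquetteChain,
      coboundary_sub, neg_sub, AddChar.map_sub_eq_div, smul_eq_mul]
    ring
  simp only [plaquetteOp, smul_mul_assoc, mul_smul_comm, map_smul, Finset.sum_mul, Finset.mul_sum,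
    map_sum, key, smul_eq_mul]
  rw [← Finset.mul_sum, ← Finset.sum_mul, AddChar.sum_apply_eq_ite, ← mul_assoc]
  congr 1
  by_cases h0 : coboundary T.dHigh (δ - ⇑a) β = 0 <;> simp [isVacant, h0]

theorem HasCharges.map_hamiltonian_mul (h : W.HasCharges ω γ δ) (F : Finset T.Low)
    (F' : Finset T.High) (a : T.Mid →₀ G) (b : T.Mid →₀ AddChar G ℂ) (B : 𝔄) :
    ω (B * (W.hamiltonian F F' * (W.x a * W.z b))) =
      -vacancies (γ - ⇑b) (δ - ⇑a) F F' * ω (B * (W.x a * W.z b)) := by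
  simp only [hamiltonian, vacancies, sub_mul, mul_sub, neg_mul, mul_neg, map_sub, map_neg,
    Finset.sum_mul, Finset.mul_sum, map_sum, h.map_starOp_mul, h.map_plaquetteOp_mul]
  push_cast
  rw [← Finset.sum_mul, ← Finset.sum_mul]
  ring

theorem HasCharges.map_hamiltonian (h : W.HasCharges ω γ δ) (F : Finset T.Low)
    (F' : Finset T.High) (B : 𝔄) :
    ω (B * W.hamiltonian F F') = -vacancies γ δ F F' * ω B := by
  have := h.map_hamiltonian_mul F F' 0 0 B
  simpa [W.x_zero, W.z_zero] using this

/-- At the right end `H` acts by its eigenvalue, minus the number of vacancies, and `-i * i = 1`.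
The commutator thus becomes `H` shifted by its eigenvalue on the state. -/
theorem HasCharges.map_commutator (h : W.HasCharges ω γ δ) (F : Finset T.Low)
    (F' : Finset T.High) (A B : 𝔄) :
    -Complex.I * ω (B * (Complex.I • (W.hamiltonian F F' * A - A * W.hamiltonian F F'))) =
      ω (B * ((W.hamiltonian F F' + (vacancies γ δ F F' : ℂ) • 1) * A)) := by
  have h1 : ω (B * (A * W.hamiltonian F F')) = -vacancies γ δ F F' * ω (B * A) := by
    rw [← mul_assoc, h.map_hamiltonian]
  have h2 : ω (B * (Complex.I • (W.hamiltonian F F' * A - A * W.hamiltonian F F'))) =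
      Complex.I * (ω (B * (W.hamiltonian F F' * A)) - ω (B * (A * W.hamiltonian F F'))) := by
    rw [mul_smul_comm, map_smul, mul_sub, map_sub, smul_eq_mul]
  have h3 : ω (B * ((W.hamiltonian F F' + (vacancies γ δ F F' : ℂ) • 1) * A)) =
      ω (B * (W.hamiltonian F F' * A)) + vacancies γ δ F F' * ω (B * A) := by
    rw [add_mul, mul_add, map_add, smul_mul_assoc, one_mul, mul_smul_comm, map_smul, smul_eq_mul]
  rw [h2, h1, h3, ← mul_assoc, neg_mul, Complex.I_mul_I]
  ring

/-- The excitation energy of a monomial: vacancies lost, that is, charges gained. The integer is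
cast through `ℝ` to match the eigenvalues in `map_star_mul_mul_nonneg`. -/
theorem HasCharges.map_excitation (h : W.HasCharges ω γ δ) (F : Finset T.Low)
    (F' : Finset T.High) (a : T.Mid →₀ G) (b : T.Mid →₀ AddChar G ℂ) (B : 𝔄) :
    ω (B * ((W.hamiltonian F F' + (vacancies γ δ F F' : ℂ) • 1) * (W.x a * W.z b))) =
      ((vacancies γ δ F F' - vacancies (γ - ⇑b) (δ - ⇑a) F F' : ℤ) : ℝ) *
        ω (B * (W.x a * W.z b)) := by
  rw [add_mul, mul_add, map_add, h.map_hamiltonian_mul, smul_mul_assoc, one_mul, mul_smul_comm,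
    map_smul, smul_eq_mul]
  push_cast
  ring

/-! ### The ground state condition -/


/-! ### The ground state condition -/

/-- A monomial is unitary, so the ground state expression for it is its excitation energy itself. -/
theorem HasCharges.vacancies_sub_nonneg (h : W.HasCharges ω γ δ) (h1 : ω 1 = 1) (a : T.Mid →₀ G)
    (b : T.Mid →₀ AddChar G ℂ) {D : 𝔄}
    (hD : Tendsto (W.commutator (W.x a * W.z b)) atTop (𝓝 D))
    (h0 : 0 ≤ -Complex.I * ω (star (W.x a * W.z b) * D)) :
    ∃ (L : Finset T.Low) (L' : Finset T.High), ∀ F F', L ⊆ F → L' ⊆ F' →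
      0 ≤ vacancies γ δ F F' - vacancies (γ - ⇑b) (δ - ⇑a) F F' := by
  obtain ⟨L, L', hL, hlim⟩ :=
    W.exists_tendsto_commutator (A := W.x a * W.z b) (Submodule.subset_span ⟨(a, b), rfl⟩)
  refine ⟨L, L', fun F F' hF hF' => ?_⟩
  have hone : star (W.x a * W.z b) * (W.x a * W.z b) = 1 := by
    rw [star_mul, W.star_x, W.star_z, mul_assoc, ← mul_assoc (W.x (-a)), W.x_neg_mul_x, one_mul,
      W.z_neg_mul_z]
  rw [tendsto_nhds_unique hD hlim, ← hL F F' hF hF', h.map_commutator, h.map_excitation, hone, h1,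
    mul_one] at h0
  exact_mod_cast h0

/-- In a ground state, local changes do not decrease the number of the charges. -/
theorem HasCharges.minimal (h : W.HasCharges ω γ δ) (h1 : ω 1 = 1)
    (hground : ∀ a b, ∃ D, Tendsto (W.commutator (W.x a * W.z b)) atTop (𝓝 D) ∧
      0 ≤ -Complex.I * ω (star (W.x a * W.z b) * D)) : StarMinimal γ ∧ PlaquetteMinimal δ := by
  classical
  constructor
  · refine starMinimal_of_sum_nonneg fun b => ?_
    obtain ⟨D, hD, h0⟩ := hground 0 b
    obtain ⟨L, L', hL⟩ := h.vacancies_sub_nonneg h1 0 b hD h0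
    have hb := finite_boundary_ne_zero (M := AddChar G ℂ) T.finite_dLow_left b
    refine ⟨L ∪ hb.toFinset, fun α hα => Finset.mem_union_right _ (by simpa using hα), ?_⟩
    -- With `a = 0` the plaquette terms cancel; the star set is enlarged to contain every cell whose
    -- charge `b` can change.
    have := hL (L ∪ hb.toFinset) L' Finset.subset_union_left subset_rfl
    rw [vacancies_sub] at this
    simpa using this
  · refine plaquetteMinimal_of_sum_nonneg fun a => ?_
    obtain ⟨D, hD, h0⟩ := hground a 0
    obtain ⟨L, L', hL⟩ := h.vacancies_sub_nonneg h1 a 0 hD h0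
    have ha := finite_coboundary_ne_zero a
    refine ⟨L' ∪ ha.toFinset, fun β hβ => Finset.mem_union_right _ (by simpa using hβ), ?_⟩
    have := hL L (L' ∪ ha.toFinset) subset_rfl Finset.subset_union_left
    rw [vacancies_sub] at this
    simpa using this

/-- If local changes do not decrease the number of the charges, the ground state condition
holds. -/
theorem HasCharges.ground [StarModule ℂ 𝔄] (h : W.HasCharges ω γ δ)
    (hω : ∀ A, 0 ≤ ω (star A * A)) (hγ : StarMinimal γ) (hδ : PlaquetteMinimal δ) {A : 𝔄}
    (hA : A ∈ W.span) : ∃ D, Tendsto (W.commutator A) atTop (𝓝 D) ∧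
      0 ≤ -Complex.I * ω (star A * D) := by
  classical
  obtain ⟨L, L', hL, hlim⟩ := W.exists_tendsto_commutator hA
  refine ⟨_, hlim, ?_⟩
  obtain ⟨c, rfl⟩ := Finsupp.mem_span_range_iff_exists_finsupp.1 hA
  have hb := fun p : (T.Mid →₀ G) × (T.Mid →₀ AddChar G ℂ) =>
    finite_boundary_ne_zero (M := AddChar G ℂ) T.finite_dLow_left p.2
  have ha := fun p : (T.Mid →₀ G) × (T.Mid →₀ AddChar G ℂ) => finite_coboundary_ne_zero p.1
  -- Large enough for the commutator with `A` to be final, and for every cell whose charge is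
  -- changed by some monomial of `A` to be counted.
  set F := L ∪ c.support.biUnion fun p => (hb p).toFinset
  set F' := L' ∪ c.support.biUnion fun p => (ha p).toFinset
  rw [← hL F F' Finset.subset_union_left Finset.subset_union_left, h.map_commutator, Finsupp.sum]
  refine map_star_mul_mul_nonneg hω (p := fun p => W.x p.1 * W.z p.2)
    (e := fun p : (T.Mid →₀ G) × (T.Mid →₀ AddChar G ℂ) =>
      ((vacancies γ δ F F' - vacancies (γ - ⇑p.2) (δ - ⇑p.1) F F' : ℤ) : ℝ)) ?_ (fun p hp => ?_)
    (fun p B => h.map_excitation F F' p.1 p.2 B) c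
  · rw [star_add, star_smul, star_one, W.star_hamiltonian]
    simp
  -- The energy is a star part depending on `b` alone plus a plaquette part depending on `a` alone,
  -- one for each minimality condition.
  · rw [Int.cast_nonneg_iff, vacancies_sub]
    refine add_nonneg (hγ.sum_nonneg p.2 fun α hα => ?_) (hδ.sum_nonneg p.1 fun β hβ => ?_)
    · exact Finset.mem_union_right _ (Finset.mem_biUnion.2 ⟨p, hp, by simpa using hα⟩)
    · exact Finset.mem_union_right _ (Finset.mem_biUnion.2 ⟨p, hp, by simpa using hβ⟩)

/-! ### Frustration free states -/

/-- The star and plaquette unitaries act trivially in `ω₀`, so what remains is the phase that `φ`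
attaches to them. -/
theorem hasCharges_comp [StarModule ℂ 𝔄] {ω₀ : 𝔄 →ₗ[ℂ] ℂ} (hω : ∀ A, 0 ≤ ω₀ (star A * A))
    (h1 : ω₀ 1 = 1) (hstar : ∀ α, ω₀ (W.starOp α) = 1) (hplaq : ∀ β, ω₀ (W.plaquetteOp β) = 1)
    {φ : 𝔄 →⋆ₐ[ℂ] 𝔄} (hx : ∀ a, φ (W.x a) = pairing γ a • W.x a)
    (hz : ∀ b, φ (W.z b) = (pairing b δ)⁻¹ • W.z b) :
    W.HasCharges (ω₀ ∘ₗ φ.toAlgHom.toLinearMap) γ δ where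
  map_star α g B := by
    have hU : ∀ g, star (W.x (T.starCochain α g)) * W.x (T.starCochain α g) = 1 := fun g => by
      rw [W.star_x, W.x_neg_mul_x]
    have hsum : ∑ g, ω₀ (W.x (T.starCochain α g)) = Fintype.card G := by
      have := hstar α
      rw [starOp, map_smul, smul_eq_mul, inv_mul_eq_one₀ (by simp)] at this
      rw [this, map_sum]
    change ω₀ (φ (B * _)) = _ * ω₀ (φ B)
    rw [map_mul, hx, mul_smul_comm, map_smul, map_mul_eq_of_sum_eq hω h1 hU hsum,
      T.pairing_starCochain, smul_eq_mul]
  map_plaquette β χ B := by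
    have hU : ∀ χ, star (W.z (T.plaquetteChain β χ)) * W.z (T.plaquetteChain β χ) = 1 :=
      fun χ => by rw [W.star_z, W.z_neg_mul_z]
    have hsum : ∑ χ : AddChar G ℂ, ω₀ (W.z (T.plaquetteChain β χ)) =
        Fintype.card (AddChar G ℂ) := by
      have := hplaq β
      rw [plaquetteOp, map_smul, smul_eq_mul, inv_mul_eq_one₀ (by simp)] at this
      rw [AddChar.card_eq, this, map_sum]
    change ω₀ (φ (B * _)) = _ * ω₀ (φ B)
    rw [map_mul, hz, mul_smul_comm, map_smul, map_mul_eq_of_sum_eq hω h1 hU hsum,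
      T.pairing_plaquetteChain, smul_eq_mul]

end WeylSystem

/-! ## The Pauli operators of the quasi-local algebra -/

section Pauli

variable {S : Type u} {G : Type v} [AddCommGroup G]

theorem pauliXOp_apply (a : S →₀ G) (ψ : Hilb S G) (h : S →₀ G) :
    pauliXOp a ψ h = ψ (h - a) := by
  rw [pauliXOp, weightedShift_apply, one_mul, sub_eq_add_neg]

theorem norm_weightedShift_le (w : (S →₀ G) → ℂ) (C : ℝ) (hw : ∀ h, ‖w h‖ ≤ C) (c : S →₀ G) :
    ‖weightedShift w C hw c‖ ≤ C := by
  apply LinearMap.mkContinuous_norm_le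
  exact (norm_nonneg _).trans (hw 0)

theorem star_pauliXOp (a : S →₀ G) : star (pauliXOp a) = pauliXOp (-a) := by
  symm
  rw [ContinuousLinearMap.star_eq_adjoint, ContinuousLinearMap.eq_adjoint_iff]
  intro ψ φ
  rw [lp.inner_eq_tsum, lp.inner_eq_tsum, ← (Equiv.addRight a).tsum_eq fun h => inner ℂ (ψ h) (pauliXOp a φ h)]
  simp only [pauliXOp_apply, Equiv.coe_addRight, add_sub_cancel_right, sub_neg_eq_add]

variable [Fintype G]

theorem pauliZOp_apply (b : S →₀ AddChar G ℂ) (ψ : Hilb S G) (h : S →₀ G) :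
    pauliZOp b ψ h = pairing b h * ψ h := by
  rw [pauliZOp, weightedShift_apply, add_zero, finsupp_prod_eq_pairing]

theorem pairing_neg_left_eq_conj (b : S →₀ AddChar G ℂ) (δ : S → G) :
    pairing (⇑(-b)) δ = star (pairing b δ) := by
  rw [pairing_eq_prod_left (s := b.support) (by simp),
    pairing_eq_prod_left (s := b.support) (by simp), star_prod]
  refine Finset.prod_congr rfl fun σ _ => ?_
  rw [Finsupp.neg_apply, AddChar.neg_apply, AddChar.map_neg_eq_conj]
  rfl

theorem star_pauliZOp (b : S →₀ AddChar G ℂ) : star (pauliZOp b) = pauliZOp (-b) := by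
  symm
  rw [ContinuousLinearMap.star_eq_adjoint, ContinuousLinearMap.eq_adjoint_iff]
  intro ψ φ
  rw [lp.inner_eq_tsum, lp.inner_eq_tsum]
  refine tsum_congr fun h => ?_
  simp only [pauliZOp_apply, pairing_neg_left_eq_conj, RCLike.inner_apply, map_mul,
    ← starRingEnd_apply, RCLike.conj_conj]
  ring

variable (S G) in
/-- The Pauli operators on the Hilbert space. -/
def pauliOp : WeylRelations S G (Hilb S G →L[ℂ] Hilb S G) where
  x := pauliXOp
  z := pauliZOp
  x_zero := by
    refine ContinuousLinearMap.ext fun ψ => lp.ext (funext fun h => ?_)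
    rw [pauliXOp_apply, sub_zero]
    rfl
  x_add a a' := by
    refine ContinuousLinearMap.ext fun ψ => lp.ext (funext fun h => ?_)
    rw [mul_apply_eq_comp, pauliXOp_apply, pauliXOp_apply, pauliXOp_apply, sub_sub]
  z_zero := by
    refine ContinuousLinearMap.ext fun ψ => lp.ext (funext fun h => ?_)
    rw [pauliZOp_apply, pairing_eq_prod_left (s := ∅) (by simp), Finset.prod_empty, one_mul]
    rfl
  z_add b b' := by
    refine ContinuousLinearMap.ext fun ψ => lp.ext (funext fun h => ?_)
    rw [mul_apply_eq_comp, pauliZOp_apply, pauliZOp_apply, pauliZOp_apply,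
      pairing_add_left, mul_assoc]
  star_x := star_pauliXOp
  star_z := star_pauliZOp
  norm_x_le a := norm_weightedShift_le _ _ _ _
  norm_z_le b := norm_weightedShift_le _ _ _ _
  z_mul_x b a := by
    refine ContinuousLinearMap.ext fun ψ => lp.ext (funext fun h => ?_)
    change (pauliZOp b (pauliXOp a ψ)) h = pairing b a * (pauliXOp a (pauliZOp b ψ)) h
    rw [pauliZOp_apply, pauliXOp_apply, pauliXOp_apply, pauliZOp_apply, ← mul_assoc,
      ← pairing_add_right, ← Finsupp.coe_add, add_sub_cancel]

/-- Fourier expansion on one site: for each shift `c` the diagonal `k ↦ M k (k + c)` is a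
combination of characters, and a character followed by a shift is a product of Pauli operators. -/
theorem siteOp_mem_span (σ : S) (M : Matrix G G ℂ) : siteOp σ M ∈ (pauliOp S G).span := by
  have h : siteOp σ M = ∑ c : G, ∑ χ : AddChar G ℂ,
      (AddChar.complexBasis G).repr (fun k => M k (k + c)) χ •
        ((pauliOp S G).z (Finsupp.single σ χ) * (pauliOp S G).x (Finsupp.single σ (-c))) := by
    refine ContinuousLinearMap.ext fun ψ => lp.ext (funext fun h => ?_)
    rw [siteOp_apply, sum_apply, lp.coeFn_sum, Finset.sum_apply]
    refine Finset.sum_congr rfl fun c _ => ?_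
    rw [sum_apply, lp.coeFn_sum, Finset.sum_apply]
    have hM := congrFun ((AddChar.complexBasis G).sum_repr fun k => M k (k + c)) (h σ)
    rw [← hM, Finset.sum_apply, Finset.sum_mul]
    refine Finset.sum_congr rfl fun χ _ => ?_
    change _ = (AddChar.complexBasis G).repr (fun k => M k (k + c)) χ *
      (pauliZOp (Finsupp.single σ χ) (pauliXOp (Finsupp.single σ (-c)) ψ)) h
    rw [pauliZOp_apply, pauliXOp_apply, pairing_eq_prod_left (s := {σ}), Finset.prod_singleton,
      Finsupp.single_eq_same, Finsupp.single_neg, sub_neg_eq_add, AddChar.complexBasis_apply,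
      Pi.smul_apply, smul_eq_mul, mul_assoc]
    intro τ hτ
    exact Finsupp.single_eq_of_ne (by simpa using hτ)
  rw [h]
  exact sum_mem fun c _ => sum_mem fun χ _ =>
    (pauliOp S G).span.smul_mem _ ((pauliOp S G).z_mul_x_mem_span _ _)

/-- Local observables are linear combinations of Pauli operators. -/
theorem localAlg_subset_span (Λ : Set S) : 
    (localAlg G Λ : Set (Hilb S G →L[ℂ] Hilb S G)) ⊆ ((pauliOp S G).span : Set _) := by
  intro A hA
  induction hA using StarAlgebra.adjoin_induction with
  | mem A hA =>
    obtain ⟨σ, -, M, rfl⟩ := hA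
    exact siteOp_mem_span σ M
  | algebraMap c =>
    rw [Algebra.algebraMap_eq_smul_one]
    exact (pauliOp S G).span.smul_mem c (pauliOp S G).one_mem_span
  | add A B _ _ hA hB => exact add_mem hA hB
  | mul A B _ _ hA hB => exact (pauliOp S G).mul_mem_span hA hB
  | star A _ hA => exact (pauliOp S G).star_mem_span hA

theorem localAlg_mono {Λ Λ' : Set S} (h : Λ ⊆ Λ') : localAlg G Λ ≤ localAlg G Λ' :=
  StarAlgebra.adjoin_mono fun _ ⟨σ, hσ, M⟩ => ⟨σ, h hσ, M⟩

theorem pauliXOp_single_mem (σ : S) (g : G) : pauliXOp (Finsupp.single σ g) ∈ localAlg G {σ} := by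
  classical
  refine StarAlgebra.subset_adjoin ℂ _
    ⟨σ, mem_singleton σ, Matrix.of fun h k => if h = k + g then 1 else 0, ?_⟩
  refine ContinuousLinearMap.ext fun ψ => lp.ext (funext fun h => ?_)
  -- In row `h σ` the shift matrix has its only nonzero entry in column `h σ - g`.
  rw [siteOp_apply, Finset.sum_eq_single (-g), pauliXOp_apply]
  · simp [sub_eq_add_neg]
  · intro c _ hc
    rw [Matrix.of_apply, if_neg, zero_mul]
    rw [add_assoc, left_eq_add]
    exact fun h' => hc (eq_neg_of_add_eq_zero_left h')
  · simp

theorem pauliZOp_single_mem (σ : S) (χ : AddChar G ℂ) :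
    pauliZOp (Finsupp.single σ χ) ∈ localAlg G {σ} := by
  classical
  refine StarAlgebra.subset_adjoin ℂ _
    ⟨σ, mem_singleton σ, Matrix.of fun h k => if h = k then χ h else 0, ?_⟩
  refine ContinuousLinearMap.ext fun ψ => lp.ext (funext fun h => ?_)
  rw [siteOp_apply, Finset.sum_eq_single 0, pauliZOp_apply, pairing_eq_prod_left (s := {σ})]
  · simp
  · intro τ hτ
    exact Finsupp.single_eq_of_ne (by simpa using hτ)
  · intro c _ hc
    rw [Matrix.of_apply, if_neg, zero_mul]
    exact fun h' => hc (left_eq_add.1 h')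
  · simp

/-- The ground state condition tests observables with finite support only, so membership in the
algebra of all sites does not suffice. -/
theorem exists_pauliXOp_mem (a : S →₀ G) : ∃ Λ : Finset S, pauliXOp a ∈ localAlg G (Λ : Set S) := by
  classical
  induction a using Finsupp.induction with
  | zero => exact ⟨∅, by
    rw [show (pauliXOp 0 : Hilb S G →L[ℂ] Hilb S G) = 1 from (pauliOp S G).x_zero]
    exact one_mem _⟩
  | single_add σ g a _ _ ih =>
    obtain ⟨Λ, hΛ⟩ := ih
    refine ⟨insert σ Λ, ?_⟩
    rw [show pauliXOp (Finsupp.single σ g + a) = pauliXOp (Finsupp.single σ g) * pauliXOp a from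
      (pauliOp S G).x_add _ _]
    exact mul_mem (localAlg_mono (by simp) (pauliXOp_single_mem σ g))
      (localAlg_mono (by simp) hΛ)

theorem exists_pauliZOp_mem (b : S →₀ AddChar G ℂ) :
    ∃ Λ : Finset S, pauliZOp b ∈ localAlg G (Λ : Set S) := by
  classical
  induction b using Finsupp.induction with
  | zero => exact ⟨∅, by
    rw [show (pauliZOp 0 : Hilb S G →L[ℂ] Hilb S G) = 1 from (pauliOp S G).z_zero]
    exact one_mem _⟩
  | single_add σ χ b _ _ ih =>
    obtain ⟨Λ, hΛ⟩ := ih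
    refine ⟨insert σ Λ, ?_⟩
    rw [show pauliZOp (Finsupp.single σ χ + b) = pauliZOp (Finsupp.single σ χ) * pauliZOp b from
      (pauliOp S G).z_add _ _]
    exact mul_mem (localAlg_mono (by simp) (pauliZOp_single_mem σ χ))
      (localAlg_mono (by simp) hΛ)

/-- Pauli operators are local. -/
theorem exists_pauli_mem (a : S →₀ G) (b : S →₀ AddChar G ℂ) :
    ∃ Λ : Finset S, pauliXOp a * pauliZOp b ∈ localAlg G (Λ : Set S) := by
  classical
  obtain ⟨Λ, hΛ⟩ := exists_pauliXOp_mem a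
  obtain ⟨Λ', hΛ'⟩ := exists_pauliZOp_mem b
  exact ⟨Λ ∪ Λ', mul_mem (localAlg_mono (by simp) hΛ) (localAlg_mono (by simp) hΛ')⟩

end Pauli

/-! ### Transfer of the Pauli operators from the Hilbert space to the quasi-local algebra. -/

section QuasiLocalPauli

variable (S : Type u) (G : Type v) [AddCommGroup G] [Fintype G]

/-- The Pauli operators in the quasi-local algebra. -/
def pauliRelations : WeylRelations S G (QuasiLocal S G) where
  x := pauliX
  z := pauliZ
  x_zero := Subtype.ext (pauliOp S G).x_zero
  x_add a a' := Subtype.ext ((pauliOp S G).x_add a a')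
  z_zero := Subtype.ext (pauliOp S G).z_zero
  z_add b b' := Subtype.ext ((pauliOp S G).z_add b b')
  star_x a := Subtype.ext ((pauliOp S G).star_x a)
  star_z b := Subtype.ext ((pauliOp S G).star_z b)
  norm_x_le a := (pauliOp S G).norm_x_le a
  norm_z_le b := (pauliOp S G).norm_z_le b
  z_mul_x b a := Subtype.ext ((pauliOp S G).z_mul_x b a)

variable {S G}

theorem mem_span_of_coe_mem {A : QuasiLocal S G}
    (hA : (A : Hilb S G →L[ℂ] Hilb S G) ∈ (pauliOp S G).span) : A ∈ (pauliRelations S G).span := by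
  obtain ⟨c, hc⟩ := Finsupp.mem_span_range_iff_exists_finsupp.1 hA
  refine Finsupp.mem_span_range_iff_exists_finsupp.2 ⟨c, Subtype.ext ?_⟩
  rw [← hc, Finsupp.sum, Finsupp.sum, AddSubmonoidClass.coe_finsetSum]
  rfl

variable (S G) in
/-- The quasi-local algebra is generated by the Pauli operators. -/
def pauliSystem : WeylSystem S G (QuasiLocal S G) where
  toWeylRelations := pauliRelations S G
  dense A := by
    have hA : (A : Hilb S G →L[ℂ] Hilb S G) ∈
        closure (localAlg G (univ : Set S) : Set (Hilb S G →L[ℂ] Hilb S G)) := A.2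
    refine Metric.mem_closure_iff.2 fun ε hε => ?_
    obtain ⟨B, hB, hAB⟩ := Metric.mem_closure_iff.1 hA ε hε
    exact ⟨⟨B, StarSubalgebra.le_topologicalClosure _ hB⟩,
      mem_span_of_coe_mem (localAlg_subset_span _ hB), hAB⟩

theorem mem_span_of_mem_localAlg {A : QuasiLocal S G} {Λ : Set S}
    (hA : (A : Hilb S G →L[ℂ] Hilb S G) ∈ localAlg G Λ) : A ∈ (pauliSystem S G).span :=
  mem_span_of_coe_mem (localAlg_subset_span _ hA)

/-- The map `rho` is built from `limUnder`, which carries information only where the limit exists.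
Convergence on the whole algebra identifies it with a composite of *-homomorphisms whose phases on
Pauli operators are known. -/
theorem exists_starAlgHom_eq_rho (γ : S → AddChar G ℂ) (δ : S → G) :
    ∃ φ : QuasiLocal S G →⋆ₐ[ℂ] QuasiLocal S G, rho γ δ = φ ∧
      (∀ a, φ (pauliX a) = pairing γ a • pauliX a) ∧
      ∀ b, φ (pauliZ b) = (pairing b δ)⁻¹ • pauliZ b := by
  obtain ⟨φ, hφ, hφx, hφz⟩ := (pauliSystem S G).exists_conj_z γ
  obtain ⟨ψ, hψ, hψx, hψz⟩ := (pauliSystem S G).exists_conj_x δ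
  refine ⟨φ.comp ψ, funext fun A => ?_, fun a => ?_, fun b => ?_⟩
  · change rhoZ γ (rhoX δ A) = φ (ψ A)
    have h : rhoX δ A = ψ A := (hψ A).limUnder_eq
    rw [h]
    exact (hφ (ψ A)).limUnder_eq
  · exact (congrArg φ (hψx a)).trans (hφx a)
  · exact (congrArg φ (hψz b)).trans ((map_smul φ _ _).trans (congrArg _ (hφz b)))

end QuasiLocalPauli

/-- The geometry enters only through the incidence numbers and their finiteness. Necessity tests
single monomials, which are local; sufficiency uses that all local observables lie in their span. -/
theorem CellSystem.isGroundState_comp_rho_iff (T : CellSystem.{u}) {G : Type v} [AddCommGroup G]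
    [Fintype G] {ω₀ : QuasiLocal T.Mid G → ℂ} (hω₀ : T.IsFrustrationFree ω₀)
    (γ : T.Mid → AddChar G ℂ) (δ : T.Mid → G) :
    T.IsGroundState (ω₀ ∘ rho γ δ) ↔ StarMinimal γ ∧ PlaquetteMinimal δ := by
  obtain ⟨φ, hφ, hφx, hφz⟩ := exists_starAlgHom_eq_rho γ δ
  set ω₁ : QuasiLocal T.Mid G →ₗ[ℂ] ℂ := IsLinearMap.mk' ω₀ hω₀.isState.linear
  have hc := WeylSystem.hasCharges_comp (W := pauliSystem T.Mid G) (ω₀ := ω₁) hω₀.isState.nonneg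
    hω₀.isState.map_one hω₀.star hω₀.plaquette hφx hφz
  set ω : QuasiLocal T.Mid G →ₗ[ℂ] ℂ := ω₁ ∘ₗ φ.toAlgHom.toLinearMap
  have hω : ω₀ ∘ rho γ δ = ω := by
    rw [hφ]
    rfl
  have hpos : ∀ A, 0 ≤ ω (star A * A) := by
    intro A
    have h : ω (star A * A) = ω₀ (star (φ A) * φ A) := by
      rw [← map_star, ← map_mul]
      rfl
    rw [h]
    exact hω₀.isState.nonneg _
  have hone : ω 1 = 1 := (congrArg ω₀ (map_one φ)).trans hω₀.isState.map_one
  rw [hω]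
  constructor
  · intro h
    refine hc.minimal hone fun a b => ?_
    obtain ⟨Λ, hΛ⟩ := exists_pauli_mem a b
    exact h.nonneg Λ (pauliX a * pauliZ b) hΛ
  · rintro ⟨hγ, hδ⟩
    refine ⟨⟨ω.isLinear, hpos, hone⟩, fun Λ A hA => ?_⟩
    exact hc.ground hpos hγ hδ (mem_span_of_mem_localAlg hA)

end KitaevCW

end

theorem proposition7 {X : Type*} [TopologicalSpace X] [T2Space X] (E : Set X)
    [CWComplex E] [RelCWComplex.FiniteDimensional E]
    (hE : LocallyFiniteIncidence E) (n : ℕ) {G : Type*} [AddCommGroup G] [Fintype G]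
    (ω₀ : QuasiLocal (RelCWComplex.cell E n) G → ℂ)
    (hω₀ : (cellSystem E hE n).IsFrustrationFree ω₀)
    (γ : RelCWComplex.cell E n → AddChar G ℂ)
    (δ : RelCWComplex.cell E n → G) :
    (cellSystem E hE n).IsGroundState (ω₀ ∘ rho γ δ) ↔
      (∀ b : RelCWComplex.cell E n →₀ AddChar G ℂ, ∃ L : ℤ,
        Tendsto (fun K : Finset (LowerCell E n) =>
          (suppCard (boundary (lowerIncidence E n) (γ + ⇑b)) K : ℤ) -
            suppCard (boundary (lowerIncidence E n) γ) K) atTop (𝓝 L) ∧ 0 ≤ L) ∧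
      (∀ a : RelCWComplex.cell E n →₀ G, ∃ L : ℤ,
        Tendsto (fun K : Finset (RelCWComplex.cell E (n + 1)) =>
          (suppCard (coboundary (incidence E n) (δ + ⇑a)) K : ℤ) -
            suppCard (coboundary (incidence E n) δ) K) atTop (𝓝 L) ∧ 0 ≤ L) := by
  -- The two minimality conditions for `cellSystem E hE n` unfold definitionally to the stated
  -- limits.
  exact CellSystem.isGroundState_comp_rho_iff (cellSystem E hE n) hω₀ γ δ
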